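/- Let $(S_t,R_t)_{t\ge 0}$ be a Markov reward process on a countable state space $\mathcal S\cup\{\emptyset\}$ with transition matrix $P$, initial distribution $\mu$, conditionally independent rewards $R_t\sim R(\cdot\mid S_t)$ with $|R_t|\le 1$ almost surely, and an absorbing terminal state $\emptyset$ with zero reward. Suppose that for some $h$ and all $s\in\mathcal S$, $p\in\mathbb N_+$, the time $T_\emptyset=\inf\{t>0:S_t=\emptyset\}$ satisfies $\mathbb E[T_\emptyset^p\mid S_0=s]\le (ph)^p$. Put $N(s)=\sum_{t\ge0}\mathbf 1\{S_t=s\}$, $\nu(s)=\sum_{t\ge 0}\mathbb P_\mu(S_t=s)$, $V^\star(s)=\mathbb E[\sum_{t\ge 0}R_t\mid S_0=s]$ and $\sigma^2_{V^\star}(s)=\mathrm{Var}[R_0+V^\star(S_1)\mid S_0=s]$. Let $\mathcal G\subseteq\mathcal S$ be finite with $\nu(s)>0$ for all $s\in\mathcal G$, let $P_{\mathcal G}=(P(s'\mid s))_{s,s'\in\mathcal G}$, and let $$\sigma^2_{\mathrm{out}}(s)=\mathbb E\Big[\sum_{t\ge1}\sigma^2_{V^\star}(S_t)\,\Big|\,S_0=s,\,S_1\notin\mathcal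 G\Big]$$ (equal to $0$ if the conditioning event has probability $0$). Given $n$ i.i.d. trajectories of the process started from $\mu$, let $\widehat{\mathbb E}_n[\,\cdot\mid S_0=s]$ be the empirical conditional mean over all their sub-trajectories (with $0/0=0$), and let the subgraph Bellman estimator $\widehat V_{\mathcal G}\in\mathbb R^{\mathcal G}$ be the solution, which almost surely exists and is unique, of $$\widehat V_{\mathcal G}(s)=\widehat{\mathbb E}_n[R_0\mid S_0=s]+\sum_{s'\in\mathcal G}\widehat{\mathbb E}_n[\mathbf 1\{S_1=s'\}\mid S_0=s]\,\widehat V_{\mathcal G}(s')+\widehat{\mathbb E}_n\Big[\mathbf 1\{S_1\notin\mathcal G\}\sum_{\ell\ge1}R_\ell\,\Big|\,S_0=s\Big],\qquad s\in\mathcal G.$$ For $s\in\mathcal G$ let $X_t(s)=\mathbf 1\{S_t=s\}\,(V^\star(s)-R_t-V^\star(S_{t+1}))$ and $Y_t(s)=\mathbf 1\{S_t=s,\,S_{t+1}\notin\mathcal G\}\,(V^\star(S_{t+1})-\sum_{t'\ge t+1}R_{t'})$, let $\Lambda^\star_{\mathcal G}$ be the covariance matrix under $\mu$ of the vector $\big(\sum_{t\ge0}(X_t(s)+Y_t(s))\big)_{s\in\mathcal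 G}$, and let $\Sigma^\star_{\mathcal G}=\mathrm{diag}(1/\nu)\,\Lambda^\star_{\mathcal G}\,\mathrm{diag}(1/\nu)$. Suppose that $\mathcal G$ is transient: $\mathbb P(S_1\notin\mathcal G,\ S_t\in\mathcal G\mid S_0=s)=0$ for all $s\in\mathcal G$ and $t\ge1$. Then all these quantities are well defined and finite, $I-P_{\mathcal G}$ is invertible, and, as $n\to\infty$, $$\sqrt n\,(V^\star_{\mathcal G}-\widehat V_{\mathcal G})\xrightarrow{d}\mathcal N\big(0,\,(I-P_{\mathcal G})^{-1}\Sigma^\star_{\mathcal G}(I-P_{\mathcal G})^{-\top}\big),$$ where $$\Sigma^\star_{\mathcal G}=\mathrm{diag}\left(\frac{\sigma^2_{V^\star}(s)+\mathbb P(S_1\notin\mathcal G\mid S_0=s)\,\sigma^2_{\mathrm{out}}(s)}{\nu(s)}\right)_{s\in\mathcal G}.$$ Moreover, for every $s\in\mathcal G$, $$\sqrt n\,(V^\star(s)-\widehat V_{\mathcal G}(s))\xrightarrow{d}\mathcal N\left(0,\ \sum_{s'\in\mathcal G}\mathbb E[N(s')\mid S_0=s]^2\,\frac{\sigma^2_{V^\star}(s')+\mathbb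 P(S_1\notin\mathcal G\mid S_0=s')\,\sigma^2_{\mathrm{out}}(s')}{\nu(s')}\right).$$ -/

import Mathlib

open MeasureTheory ProbabilityTheory Filter Topology
open scoped ENNReal Matrix

/-- A Markov reward process on the augmented state space `X` (all states together with the
terminal state): transition kernel, reward distributions, initial distribution, and an absorbing
terminal state at which the reward is zero. -/
structure MRP (X : Type*) [MeasurableSpace X] where
  /-- transition kernel `P(· | s)` -/
  trans : Kernel X X
  /-- reward distribution `R(· | s)` -/
  reward : Kernel X ℝ
  /-- initial distribution `μ` -/
  init : Measure X
  /-- terminal state `∅` -/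
  terminal : X
  [isMarkovKernel_trans : IsMarkovKernel trans]
  [isMarkovKernel_reward : IsMarkovKernel reward]
  [isProbabilityMeasure_init : IsProbabilityMeasure init]
  trans_terminal : trans terminal = Measure.dirac terminal
  reward_terminal : reward terminal = Measure.dirac 0

attribute [instance] MRP.isMarkovKernel_trans MRP.isMarkovKernel_reward
  MRP.isProbabilityMeasure_init

namespace MRP

/-- A path `((S₀, R₀), (S₁, R₁), …)`. A trajectory that stops when it hits the terminal state is
identified with the infinite path that stays at (terminal state, zero reward) from then on. -/
abbrev Path (X : Type*) := ℕ → X × ℝ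

section

variable {X : Type*}

/-- The state `S_t`. -/
def state (t : ℕ) (x : Path X) : X := (x t).1

/-- The reward `R_t`. -/
def rew (t : ℕ) (x : Path X) : ℝ := (x t).2

/-- The sub-trajectory that starts at time `t`. -/
def shift (t : ℕ) (x : Path X) : Path X := fun k => x (t + k)

/-- The total reward `∑_{ℓ ≥ t} R_ℓ` from time `t` on. -/
noncomputable def rewardToGo (t : ℕ) (x : Path X) : ℝ := ∑' l, rew (t + l) x

/-- The number of visits `N(s) = ∑_{t ≥ 0} 1{S_t = s}`. -/
noncomputable def visits [DecidableEq X] (s : X) (x : Path X) : ℝ≥0∞ :=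
  ∑' t, if state t x = s then 1 else 0

end

section Model

variable {X : Type*} [MeasurableSpace X] (M : MRP X)

/-- One step of the chain `(S_t, R_t)`: `S_{t+1} ∼ P(· | S_t)` and then
`R_{t+1} ∼ R(· | S_{t+1})`. -/
noncomputable def step : Kernel (X × ℝ) (X × ℝ) :=
  (M.trans ⊗ₖ M.reward.prodMkLeft X).comap Prod.fst measurable_fst

instance : IsMarkovKernel M.step := by
  unfold step; infer_instance

/-- The same step as a kernel from histories up to time `n`. -/
noncomputable def stepHist (n : ℕ) :
    Kernel (Π _ : Finset.Iic n, X × ℝ) (X × ℝ) :=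
  M.step.comap (fun y => y ⟨n, Finset.mem_Iic.2 le_rfl⟩) (measurable_pi_apply _)

instance (n : ℕ) : IsMarkovKernel (M.stepHist n) := by
  unfold stepHist; infer_instance

/-- The law of the path `(S_t, R_t)_{t ≥ 0}` when `S₀ ∼ ρ`. -/
noncomputable def pathLaw (ρ : Measure X) : Measure (Path X) :=
  Kernel.trajMeasure (X := fun _ => X × ℝ) (ρ ⊗ₘ M.reward) M.stepHist

/-- The conditional law of the path given `S₀ = s`. -/
noncomputable def lawFrom (s : X) : Measure (Path X) := M.pathLaw (Measure.dirac s)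

/-- `T_∅ = inf {t > 0 : S_t = ∅}`. -/
noncomputable def hitTime (x : Path X) : ℝ≥0∞ :=
  ⨅ (t : ℕ) (_ : 0 < t ∧ state t x = M.terminal), (t : ℝ≥0∞)

/-- Effective horizon `h`: `E[T_∅ ^ p | S₀ = s] ≤ (p h) ^ p` for all non-terminal `s` and all
integers `p ≥ 1`. -/
def EffectiveHorizon (h : ℝ) : Prop :=
  ∀ s, s ≠ M.terminal → ∀ p : ℕ, 1 ≤ p →
    ∫⁻ x, (M.hitTime x) ^ p ∂(M.lawFrom s) ≤ ENNReal.ofReal ((p * h) ^ p)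

/-- Rewards are bounded by `1` almost surely. -/
def BoundedReward : Prop := ∀ s, ∀ᵐ r ∂(M.reward s), |r| ≤ 1

/-- The value function `V⋆(s) = E[∑_{t ≥ 0} R_t | S₀ = s]`. -/
noncomputable def value (s : X) : ℝ := ∫ x, rewardToGo 0 x ∂(M.lawFrom s)

/-- The one-step variance `σ²_{V⋆}(s) = Var[R₀ + V⋆(S₁) | S₀ = s]`. -/
noncomputable def oneStepVar (s : X) : ℝ :=
  Var[fun x => rew 0 x + M.value (state 1 x); M.lawFrom s]

/-- The occupancy measure `ν(s) = ∑_{t ≥ 0} P_μ(S_t = s)`. -/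
noncomputable def occupancy (s : X) : ℝ≥0∞ :=
  ∑' t, M.pathLaw M.init {x | state t x = s}

/-- `E[N(s') | S₀ = s]`. -/
noncomputable def expectedVisits [DecidableEq X] (s s' : X) : ℝ≥0∞ :=
  ∫⁻ x, visits s' x ∂(M.lawFrom s)

/-- `G` is transient: after leaving `G` the chain never comes back to `G`. -/
def IsTransient (G : Finset X) : Prop :=
  ∀ s ∈ G, ∀ t : ℕ, 1 ≤ t → M.lawFrom s {x | state 1 x ∉ G ∧ state t x ∈ G} = 0

/-- The exit probability `P(S₁ ∉ G | S₀ = s)`. -/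
noncomputable def exitProb (G : Finset X) (s : X) : ℝ :=
  (M.lawFrom s).real {x | state 1 x ∉ G}

/-- `σ²_out(s) = E[∑_{t ≥ 1} σ²_{V⋆}(S_t) | S₀ = s, S₁ ∉ G]`, which is `0` if the conditioning
event has probability zero. -/
noncomputable def sigmaOut (G : Finset X) (s : X) : ℝ :=
  ∫ x, ∑' t : ℕ, M.oneStepVar (state (t + 1) x) ∂(cond (M.lawFrom s) {x | state 1 x ∉ G})

/-- The restriction `P_G` of the transition matrix to `G`. -/
noncomputable def transOn (G : Finset X) : Matrix G G ℝ :=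
  Matrix.of fun s s' => (M.trans s).real {(s' : X)}

section Covariance

variable [DecidableEq X] (G : Finset X)

/-- The one-step (temporal difference) error
`X_t(s) = 1{S_t = s} (V⋆(s) - R_t - V⋆(S_{t+1}))`. -/
noncomputable def tdTerm (s : X) (t : ℕ) (x : Path X) : ℝ :=
  if state t x = s then M.value s - rew t x - M.value (state (t + 1) x) else 0

/-- The Monte Carlo error
`Y_t(s) = 1{S_t = s, S_{t+1} ∉ G} (V⋆(S_{t+1}) - ∑_{t' ≥ t+1} R_{t'})`. -/
noncomputable def mcTerm (s : X) (t : ℕ) (x : Path X) : ℝ :=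
  if state t x = s ∧ state (t + 1) x ∉ G then
    M.value (state (t + 1) x) - rewardToGo (t + 1) x else 0

/-- `∑_{t ≥ 0} (X_t(s) + Y_t(s))`. -/
noncomputable def score (s : X) (x : Path X) : ℝ :=
  ∑' t, (M.tdTerm s t x + M.mcTerm G s t x)

/-- `Λ⋆_G`, the covariance matrix of the vector `∑_t (X_t + Y_t)` along one trajectory of the
process. -/
noncomputable def lambdaStar : Matrix G G ℝ :=
  Matrix.of fun s s' => cov[M.score G s, M.score G s'; M.pathLaw M.init]

/-- `Σ⋆_G = diag(1/ν) Λ⋆_G diag(1/ν)`. -/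
noncomputable def sigmaStar : Matrix G G ℝ :=
  Matrix.diagonal (fun s : G => 1 / (M.occupancy s).toReal) * M.lambdaStar G *
    Matrix.diagonal (fun s : G => 1 / (M.occupancy s).toReal)

/-- `(σ²_{V⋆}(s) + P(S₁ ∉ G | S₀ = s) σ²_out(s)) / ν(s)`. -/
noncomputable def effVar (s : X) : ℝ :=
  (M.oneStepVar s + M.exitProb G s * M.sigmaOut G s) / (M.occupancy s).toReal

/-- All the sums, expectations and variances above are genuine: paths terminate almost surely (so
that sums over time have finitely many nonzero terms), all integrands are integrable, and the
occupancies and expected numbers of visits to `G` are finite. -/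
structure WellDefined : Prop where
  terminates : ∀ s, ∀ᵐ x ∂(M.lawFrom s), ∃ T, ∀ t ≥ T, x t = (M.terminal, 0)
  terminates_init : ∀ᵐ x ∂(M.pathLaw M.init), ∃ T, ∀ t ≥ T, x t = (M.terminal, 0)
  integrable_return : ∀ s, Integrable (rewardToGo 0) (M.lawFrom s)
  memLp_oneStep : ∀ s, MemLp (fun x => rew 0 x + M.value (state 1 x)) 2 (M.lawFrom s)
  integrable_sigmaOut : ∀ s, Integrable
    (fun x => ∑' t : ℕ, M.oneStepVar (state (t + 1) x))
      (cond (M.lawFrom s) {x | state 1 x ∉ G})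
  occupancy_lt_top : ∀ s ∈ G, M.occupancy s < ∞
  expectedVisits_lt_top : ∀ s ∈ G, ∀ s' ∈ G, M.expectedVisits s s' < ∞
  memLp_score : ∀ s ∈ G, MemLp (M.score G s) 2 (M.pathLaw M.init)

end Covariance

end Model

section Estimator

variable {X : Type*} [DecidableEq X] {n : ℕ} (G : Finset X) (D : Fin n → Path X)

/-- The empirical conditional mean of `f` given `S₀ = s` over the pooled data set of all
sub-trajectories of the `n` trajectories, with the convention `0 / 0 = 0`. (Only non-terminal `s`
are used, so that times after termination do not contribute.) -/
noncomputable def empMean (f : Path X → ℝ) (s : X) : ℝ :=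
  (∑ i, ∑' t, if state t (D i) = s then f (shift t (D i)) else 0) /
    ∑ i, ∑' t, if state t (D i) = s then (1 : ℝ) else 0

/-- The empirical mean reward at `s`. -/
noncomputable def empReward (s : X) : ℝ := empMean D (rew 0) s

/-- The empirical transition probability from `s` to `s'`. -/
noncomputable def empTrans (s s' : X) : ℝ :=
  empMean D (fun x => if state 1 x = s' then 1 else 0) s

/-- The Monte Carlo estimate at `s` of the reward collected after an exit from `G` in the first
step. -/
noncomputable def empOut (s : X) : ℝ :=
  empMean D (fun x => if state 1 x ∉ G then rewardToGo 1 x else 0) s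

/-- `v` is a subgraph Bellman estimate from the data `D`: it solves the empirical fixed-point
equation `v = r̂_G + P̂_G v + V̂_out`. -/
def IsSubgraphBellman (v : G → ℝ) : Prop :=
  ∀ s : G, v s = empReward D s + ∑ s' : G, empTrans D s s' * v s' + empOut G D s

end Estimator

end MRP

/-! The estimation error satisfies an exact algebraic identity. The `score` of `s` sums, over the
visits to `s`, the difference between `V⋆(s)` and the estimator's regression target with `V⋆`
plugged in. Applying `1 - P̂_G` to `V⋆ - V̂` therefore gives, at `s`, the total score divided by the
number of visits to `s` (`value_sub_estimate_eq`). Hence `√n (V⋆ - V̂)` is the matrix `(1 - P̂_G)⁻¹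
diag(n / visits)` applied to `1/√n` times a sum of i.i.d. centered vectors. The strong law sends the
matrix to `(1 - P_G)⁻¹ diag(1/ν)` almost surely, the central limit theorem handles the scores, and
Slutsky's lemma combines the two (`tendstoInDistribution_error`).

The diagonal form of the covariance is a martingale computation. Put `δ_u = V⋆(S_u) - R_u -
V⋆(S_{u+1})`. The Monte Carlo error after an exit telescopes into the later `δ_u`, so the score is
`∑_u c_u(s) δ_u`, where `c_u(s)` (`coef`) depends only on the states up to time `u`
(`score_eq_sum`). By the Bellman equation `δ_u` is conditionally centered with conditional variance
`σ²(S_u)`, so the covariance of the scores of `s` and `s'` is `∑_u E[c_u(s) c_u(s') σ²(S_u)]`.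
Transience enters here: a path leaves `G` at most once, so at each time the `c_u(s)`, `s ∈ G`, are
indicators of disjoint events, namely being at `s` or having left `G` from `s`
(`LeavesOnce.coef_mul_coef`). The off-diagonal entries vanish; on the diagonal, regrouping by visits
and the Markov property produce the stated variance times `ν(s)` (`integral_score_sq`).

Transience also closes first-step analysis on `G`, which identifies `(1 - P_G)⁻¹` with the expected
visit counts (`expectedVisits_eq`) and yields the scalar limit. Limits are exchanged with integrals
by domination through the lifetime `life`, whose first two moments come from the effective horizon.
Solvability of the empirical equation is deterministic: a maximum principle, given that all data end
outside `G` (`nonpos_of_empTrans_fixed`). -/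

namespace MRP

/-! ### Uniqueness of the law of the chain and the Markov property at a fixed time. -/

section Markov

variable {X : Type*} [MeasurableSpace X]

/-- The path frozen at time `b`. -/
def trunc (b : ℕ) (x : Path X) : Path X := fun k => x (min k b)

/-- The path that follows `x` before time `u` and `y` from time `u` on. -/
def splice (u : ℕ) (x y : Path X) : Path X := fun k => if k < u then x k else y (k - u)

@[fun_prop]
theorem measurable_state (t : ℕ) : Measurable (state t : Path X → X) :=
  measurable_fst.comp (measurable_pi_apply t)

@[fun_prop]
theorem measurable_rew (t : ℕ) : Measurable (rew t : Path X → ℝ) :=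
  measurable_snd.comp (measurable_pi_apply t)

@[fun_prop]
theorem measurable_shift (t : ℕ) : Measurable (shift t : Path X → Path X) :=
  measurable_pi_lambda _ fun _ => measurable_pi_apply _

@[fun_prop]
theorem measurable_trunc (b : ℕ) : Measurable (trunc b : Path X → Path X) :=
  measurable_pi_lambda _ fun _ => measurable_pi_apply _

@[fun_prop]
theorem measurable_splice (u : ℕ) :
    Measurable (fun p : Path X × Path X => splice u p.1 p.2) := by
  refine measurable_pi_lambda _ fun k => ?_
  by_cases hk : k < u
  · simp only [splice, hk, if_true]
    exact (measurable_pi_apply k).comp measurable_fst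
  · simp only [splice, hk, if_false]
    exact (measurable_pi_apply (k - u)).comp measurable_snd

variable (M : MRP X)

/-- `μ` makes the coordinate process a Markov chain with transition kernel `M.step`. -/
def IsChain (μ : Measure (Path X)) : Prop :=
  ∀ (b : ℕ) (f : Path X × (X × ℝ) → ℝ≥0∞), Measurable f →
    ∫⁻ x, f (trunc b x, x (b + 1)) ∂μ = ∫⁻ x, ∫⁻ z, f (trunc b x, z) ∂(M.step (x b)) ∂μ

instance isProbabilityMeasure_pathLaw (ρ : Measure X) [IsProbabilityMeasure ρ] :
    IsProbabilityMeasure (M.pathLaw ρ) := by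
  unfold pathLaw; infer_instance

instance isProbabilityMeasure_lawFrom (s : X) : IsProbabilityMeasure (M.lawFrom s) := by
  unfold lawFrom; infer_instance

theorem lintegral_step (f : X × ℝ → ℝ≥0∞) (hf : Measurable f) (a : X × ℝ) :
    ∫⁻ z, f z ∂(M.step a) = ∫⁻ s, ∫⁻ r, f (s, r) ∂(M.reward s) ∂(M.trans a.1) := by
  rw [step, Kernel.comap_apply, Kernel.lintegral_compProd _ _ _ hf]
  simp [Kernel.prodMkLeft_apply]

theorem isChain_pathLaw (ρ : Measure X) [IsProbabilityMeasure ρ] : M.IsChain (M.pathLaw ρ) := by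
  intro b f hf
  have key := Kernel.map_frestrictLe_trajMeasure_compProd_eq_map_trajMeasure
    (X := fun _ => X × ℝ) (μ₀ := ρ ⊗ₘ M.reward) (κ := M.stepHist) (a := b)
  -- `g` extends a finite history by freezing it, so `g` after restriction to `Iic b` is `trunc b`.
  let g : (Π _ : Finset.Iic b, X × ℝ) → Path X :=
    fun y k => y ⟨min k b, Finset.mem_Iic.2 (min_le_right _ _)⟩
  have hg : Measurable g := measurable_pi_lambda _ fun _ => measurable_pi_apply _
  have hF : Measurable (fun p : (Π _ : Finset.Iic b, X × ℝ) × (X × ℝ) => f (g p.1, p.2)) := by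
    fun_prop
  have h := congrArg (fun m => ∫⁻ p, f (g p.1, p.2) ∂m) key
  rw [Measure.lintegral_compProd hF, lintegral_map hF (by fun_prop),
    lintegral_map (Measurable.lintegral_kernel_prod_right hF) (by fun_prop)] at h
  exact h.symm

theorem map_zero_pathLaw (ρ : Measure X) [IsProbabilityMeasure ρ] :
    (M.pathLaw ρ).map (fun x => x 0) = ρ ⊗ₘ M.reward := by
  have h0 : (fun x : Path X => x 0) =
      (MeasurableEquiv.piUnique (fun _ : Finset.Iic 0 => X × ℝ)) ∘ Preorder.frestrictLe 0 := by
    ext x <;> rfl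
  rw [h0, ← Measure.map_map (MeasurableEquiv.measurable _) (by fun_prop), pathLaw,
    Kernel.trajMeasure, Measure.map_comp _ _ (by fun_prop), Kernel.traj_map_frestrictLe,
    Kernel.partialTraj_self, Measure.id_comp,
    Measure.map_map (MeasurableEquiv.measurable _) (MeasurableEquiv.measurable _),
    MeasurableEquiv.self_comp_symm, Measure.map_id]

variable {M}

/-- The chain property determines the law of the path frozen at `b + 1` from the law of the path
frozen at `b`. By induction these laws agree for all `b`; they contain all finite-dimensional
marginals, and a projective limit is unique. -/
theorem IsChain.ext {μ ν : Measure (Path X)} [IsProbabilityMeasure μ] [IsProbabilityMeasure ν]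
    (hμ : M.IsChain μ) (hν : M.IsChain ν)
    (h0 : μ.map (fun x => x 0) = ν.map (fun x => x 0)) : μ = ν := by
  have htr : ∀ b, μ.map (trunc b) = ν.map (trunc b) := by
    intro b
    induction b with
    | zero =>
      have : (trunc 0 : Path X → Path X) = (fun a _ => a) ∘ (fun x => x 0) := by
        ext x <;> simp [trunc]
      rw [this, ← Measure.map_map (by fun_prop) (by fun_prop), h0,
        Measure.map_map (by fun_prop) (by fun_prop)]
    | succ b ih =>
      let ins : Path X × (X × ℝ) → Path X := fun p k => if k ≤ b then p.1 k else p.2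
      have hins : Measurable ins := by
        refine measurable_pi_lambda _ fun k => ?_
        by_cases hk : k ≤ b
        · simp only [ins, hk, if_true]; fun_prop
        · simp only [ins, hk, if_false]; fun_prop
      have hti : ∀ x : Path X, trunc (b + 1) x = ins (trunc b x, x (b + 1)) := by
        intro x
        ext k : 1
        by_cases hk : k ≤ b
        · simp [trunc, ins, hk, min_eq_left (hk.trans (Nat.le_succ b))]
        · simp [trunc, ins, hk, min_eq_right (by omega : b + 1 ≤ k)]
      have hval : ∀ m : Measure (Path X), M.IsChain m → ∀ f : Path X → ℝ≥0∞, Measurable f →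
          ∫⁻ x, f x ∂(m.map (trunc (b + 1))) =
            ∫⁻ y, ∫⁻ z, f (ins (y, z)) ∂(M.step (y b)) ∂(m.map (trunc b)) := by
        intro m hm f hf
        rw [lintegral_map hf (by fun_prop)]
        simp_rw [hti]
        rw [hm b (fun p => f (ins p)) (by fun_prop), lintegral_map _ (by fun_prop)]
        · simp [trunc]
        · have : Measurable (fun p : Path X × (X × ℝ) => f (ins p)) := by fun_prop
          exact Measurable.lintegral_kernel_prod_right
            (κ := M.step.comap (fun y : Path X => y b) (measurable_pi_apply b)) this
      refine Measure.ext_of_lintegral _ fun f hf => ?_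
      rw [hval μ hμ f hf, hval ν hν f hf, ih]
  have hfin : ∀ m : Measure (Path X), ∀ I : Finset ℕ,
      m.map I.restrict = (m.map (trunc (I.sup id))).map I.restrict := by
    intro m I
    rw [Measure.map_map (by fun_prop) (by fun_prop)]
    congr 1
    ext x i : 2
    have : (i : ℕ) ≤ I.sup id := Finset.le_sup (f := id) i.2
    simp [trunc, min_eq_left this]
  refine IsProjectiveLimit.unique (P := fun I => ν.map I.restrict) (fun I => ?_) (fun I => rfl)
  change μ.map I.restrict = ν.map I.restrict
  rw [hfin μ, hfin ν, htr]

variable (M)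
variable [Countable X] [MeasurableSingletonClass X]

/-- The conditional law of the path given the initial state, as a kernel. -/
noncomputable def lawKernel : Kernel X (Path X) := ⟨M.lawFrom, measurable_of_countable _⟩

@[simp]
theorem lawKernel_apply (s : X) : M.lawKernel s = M.lawFrom s := rfl

instance : IsMarkovKernel M.lawKernel := ⟨fun s => by rw [lawKernel_apply]; infer_instance⟩

theorem lintegral_lawFrom_zero (s : X) (f : X × ℝ → ℝ≥0∞) (hf : Measurable f) :
    ∫⁻ y, f (y 0) ∂(M.lawFrom s) = ∫⁻ r, f (s, r) ∂(M.reward s) := by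
  rw [← lintegral_map (g := fun y : Path X => y 0) hf (by fun_prop), lawFrom, map_zero_pathLaw,
    Measure.lintegral_compProd hf, lintegral_dirac]

/-- **Markov property**: the law of the path is obtained by running it up to time `u` and then
restarting it from the state reached. -/
theorem map_splice (ρ : Measure X) [IsProbabilityMeasure ρ] (u : ℕ) :
    (M.pathLaw ρ ⊗ₘ M.lawKernel.comap (state u) (measurable_state u)).map
      (fun p => splice u p.1 p.2) = M.pathLaw ρ := by
  set η := (M.pathLaw ρ ⊗ₘ M.lawKernel.comap (state u) (measurable_state u)).map
      (fun p => splice u p.1 p.2) with hη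
  have : IsProbabilityMeasure η := Measure.isProbabilityMeasure_map (by fun_prop)
  have hint : ∀ f : Path X → ℝ≥0∞, Measurable f →
      ∫⁻ x, f x ∂η = ∫⁻ x, ∫⁻ y, f (splice u x y) ∂(M.lawFrom (state u x)) ∂(M.pathLaw ρ) := by
    intro f hf
    rw [hη, lintegral_map hf (by fun_prop), Measure.lintegral_compProd (by fun_prop)]
    simp
  have hker : ∀ b, ∀ f : Path X × (X × ℝ) → ℝ≥0∞, Measurable f →
      Measurable (fun x : Path X => ∫⁻ z, f (trunc b x, z) ∂(M.step (x b))) := by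
    intro b f hf
    have : Measurable (fun p : Path X × (X × ℝ) => f (trunc b p.1, p.2)) := by fun_prop
    exact Measurable.lintegral_kernel_prod_right
      (κ := M.step.comap (fun y : Path X => y b) (measurable_pi_apply b)) this
  refine IsChain.ext (M := M) ?_ (M.isChain_pathLaw ρ) ?_
  · intro b f hf
    rw [hint _ (by fun_prop), hint _ (hker b f hf)]
    -- Position of the step `b → b + 1` relative to `u`. Before `u` only the old path is seen. At `b
    -- + 1 = u` the state is kept and only its reward is redrawn, which does not change the one-step
    -- law. After `u` the step lies inside the restarted path.
    rcases lt_trichotomy (b + 1) u with hb | hb | hb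
    · have h1 : ∀ x y : Path X, trunc b (splice u x y) = trunc b x := by
        intro x y; ext k : 1; simp [trunc, splice]; omega
      simp only [h1]
      simp only [splice, hb, if_true, (by omega : b < u), lintegral_const, measure_univ, mul_one]
      exact M.isChain_pathLaw ρ b f hf
    · subst hb
      have h1 : ∀ x y : Path X, trunc b (splice (b + 1) x y) = trunc b x := by
        intro x y; ext k : 1; simp [trunc, splice]
      simp only [h1]
      simp only [splice, lt_self_iff_false, if_false, Nat.sub_self, Nat.lt_succ_self, if_true,
        lintegral_const, measure_univ, mul_one]
      simp_rw [fun x : Path X => M.lintegral_lawFrom_zero (state (b + 1) x)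
        (fun z => f (trunc b x, z)) (by fun_prop)]
      have hf' : Measurable (fun p : (Path X × (X × ℝ)) × ℝ => f (p.1.1, (p.1.2.1, p.2))) := by
        fun_prop
      refine (M.isChain_pathLaw ρ b (fun p => ∫⁻ r, f (p.1, (p.2.1, r)) ∂(M.reward p.2.1))
        (Measurable.lintegral_kernel_prod_right
          (κ := M.reward.comap (fun p : Path X × (X × ℝ) => p.2.1) (by fun_prop)) hf')).trans ?_
      refine lintegral_congr fun x => ?_
      have hf'' : Measurable (fun p : (X × ℝ) × ℝ => f (trunc b x, (p.1.1, p.2))) := by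
        fun_prop
      have hm : Measurable (fun z : X × ℝ => ∫⁻ r, f (trunc b x, (z.1, r)) ∂(M.reward z.1)) :=
        Measurable.lintegral_kernel_prod_right'
          (κ := M.reward.comap (fun p : X × ℝ => p.1) (by fun_prop)) hf''
      refine (lintegral_step M _ hm (x b)).trans ?_
      rw [lintegral_step _ _ (by fun_prop)]
      simp
    · obtain ⟨c, rfl⟩ : ∃ c, b = u + c := ⟨b - u, by omega⟩
      refine lintegral_congr fun x => ?_
      have h1 : ∀ y : Path X, trunc (u + c) (splice u x y) = splice u x (trunc c y) := by
        intro y; ext k : 1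
        by_cases hk : k < u
        · simp [trunc, splice, hk, min_eq_left (by omega : k ≤ u + c)]
        · have h2 : ¬ (min k (u + c) < u) := by omega
          have h3 : min k (u + c) - u = min (k - u) c := by omega
          simp only [trunc, splice, hk, h2, if_false, h3]
      have h2 : ∀ y : Path X, splice u x y (u + c + 1) = y (c + 1) := by
        intro y
        rw [splice, if_neg (by omega), (by omega : u + c + 1 - u = c + 1)]
      have h3 : ∀ y : Path X, splice u x y (u + c) = y c := by
        intro y; simp [splice]
      simp only [h1, h2, h3]
      exact M.isChain_pathLaw (Measure.dirac (state u x)) c (fun p => f (splice u x p.1, p.2))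
        (by fun_prop)
  · refine Measure.ext_of_lintegral _ fun f hf => ?_
    rw [lintegral_map hf (by fun_prop), hint _ (by fun_prop)]
    rcases Nat.eq_zero_or_pos u with rfl | hu
    · simp only [splice, Nat.not_lt_zero, if_false, Nat.sub_zero]
      simp_rw [M.lintegral_lawFrom_zero _ f hf]
      rw [map_zero_pathLaw, Measure.lintegral_compProd hf]
      have h4 : Measurable (fun s => ∫⁻ r, f (s, r) ∂(M.reward s)) := measurable_of_countable _
      have h5 := lintegral_map (μ := M.pathLaw ρ) (g := fun x : Path X => x 0)
        (f := fun a : X × ℝ => ∫⁻ r, f (a.1, r) ∂(M.reward a.1)) (h4.comp measurable_fst)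
        (by fun_prop)
      rw [map_zero_pathLaw, Measure.lintegral_compProd (f := fun a : X × ℝ =>
        ∫⁻ r, f (a.1, r) ∂(M.reward a.1)) (h4.comp measurable_fst)] at h5
      simpa [state] using h5.symm
    · simp only [splice, hu, if_true, lintegral_const, measure_univ, mul_one]
      rw [lintegral_map hf (by fun_prop)]

end Markov

end MRP

namespace MRP

/-! ### Consequences of the Markov property: integration, null sets, conditioning on the past. -/

section Markov

variable {X : Type*}

@[simp]
theorem shift_splice (u : ℕ) (x y : Path X) : shift u (splice u x y) = y := by
  ext k : 1
  simp [shift, splice]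

@[simp]
theorem splice_zero (x y : Path X) : splice 0 x y = y := by
  ext k : 1
  simp [splice]

theorem state_shift (t u : ℕ) (x : Path X) : state t (shift u x) = state (u + t) x := rfl

theorem rew_shift (t u : ℕ) (x : Path X) : rew t (shift u x) = rew (u + t) x := rfl

theorem rewardToGo_shift (t u : ℕ) (x : Path X) :
    rewardToGo t (shift u x) = rewardToGo (u + t) x := by
  simp [rewardToGo, rew_shift, add_assoc]

variable [MeasurableSpace X] [Countable X] [MeasurableSingletonClass X] (M : MRP X)

theorem lintegral_splice (ρ : Measure X) [IsProbabilityMeasure ρ] (u : ℕ) (f : Path X → ℝ≥0∞)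
    (hf : Measurable f) :
    ∫⁻ x, f x ∂(M.pathLaw ρ) =
      ∫⁻ x, ∫⁻ y, f (splice u x y) ∂(M.lawFrom (state u x)) ∂(M.pathLaw ρ) := by
  conv_lhs => rw [← M.map_splice ρ u]
  rw [lintegral_map hf (by fun_prop), Measure.lintegral_compProd (by fun_prop)]
  simp

theorem integral_splice (ρ : Measure X) [IsProbabilityMeasure ρ] (u : ℕ) (f : Path X → ℝ)
    (hf : Integrable f (M.pathLaw ρ)) :
    ∫ x, f x ∂(M.pathLaw ρ) =
      ∫ x, ∫ y, f (splice u x y) ∂(M.lawFrom (state u x)) ∂(M.pathLaw ρ) := by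
  have hm : Measurable (fun p : Path X × Path X => splice u p.1 p.2) := by fun_prop
  have hf' := hf
  rw [← M.map_splice ρ u] at hf'
  conv_lhs => rw [← M.map_splice ρ u]
  rw [integral_map hm.aemeasurable hf'.1, Measure.integral_compProd]
  · simp
  · exact (integrable_map_measure hf'.1 hm.aemeasurable).1 hf'

theorem lintegral_init (ρ : Measure X) [IsProbabilityMeasure ρ] (f : Path X → ℝ≥0∞)
    (hf : Measurable f) :
    ∫⁻ x, f x ∂(M.pathLaw ρ) = ∫⁻ x, ∫⁻ y, f y ∂(M.lawFrom (state 0 x)) ∂(M.pathLaw ρ) := by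
  simpa using M.lintegral_splice ρ 0 f hf

theorem ae_state_zero (s : X) : ∀ᵐ x ∂(M.lawFrom s), state 0 x = s := by
  have hm : Measurable (Set.indicator ({s}ᶜ : Set X) (fun _ => (1 : ℝ≥0∞))) :=
    measurable_of_countable _
  have h := M.lintegral_lawFrom_zero s (fun a => Set.indicator ({s}ᶜ) (fun _ => (1 : ℝ≥0∞)) a.1)
    (hm.comp measurable_fst)
  simp only [Set.mem_compl_iff, Set.mem_singleton_iff, not_true_eq_false, not_false_eq_true,
    Set.indicator_of_notMem, lintegral_const, zero_mul] at h
  replace h := (lintegral_eq_zero_iff (hm.comp (measurable_state 0))).1 h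
  filter_upwards [h] with x hx
  by_contra hne
  rw [Function.comp_apply, Pi.zero_apply, Set.indicator_of_mem (by exact hne)] at hx
  exact one_ne_zero hx

theorem map_rew_zero (s : X) : (M.lawFrom s).map (rew 0) = M.reward s := by
  refine Measure.ext_of_lintegral _ fun f hf => ?_
  rw [lintegral_map hf (by fun_prop)]
  exact M.lintegral_lawFrom_zero s (fun a => f a.2) (by fun_prop)

theorem map_state_one (s : X) : (M.lawFrom s).map (state 1) = M.trans s := by
  refine Measure.ext_of_lintegral _ fun f hf => ?_
  rw [lintegral_map hf (by fun_prop)]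
  have h := M.isChain_pathLaw (Measure.dirac s) 0 (fun p => f p.2.1) (by fun_prop)
  refine h.trans ?_
  change ∫⁻ x, _ ∂(M.lawFrom s) = _
  have h2 : ∀ᵐ x ∂(M.lawFrom s), ∫⁻ z, f z.1 ∂(M.step (x 0)) = ∫⁻ y, f y ∂(M.trans s) := by
    filter_upwards [M.ae_state_zero s] with x hx
    rw [lintegral_step _ _ (by fun_prop)]
    simp only [lintegral_const, measure_univ, mul_one]
    rw [show (x 0).1 = s from hx]
  rw [lintegral_congr_ae h2]
  simp

/-- `p` need not be measurable. Pinning the initial state to `s` in each exceptional set makes their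
countable union measurable and null under every `lawFrom s` at once, so the Markov property at time
`t` applies to it. -/
theorem ae_shift {p : Path X → Prop} (hp : ∀ s, ∀ᵐ y ∂(M.lawFrom s), p y)
    (ρ : Measure X) [IsProbabilityMeasure ρ] (t : ℕ) :
    ∀ᵐ x ∂(M.pathLaw ρ), p (shift t x) := by
  let N : X → Set (Path X) := fun s => {y | state 0 y = s} ∩ toMeasurable (M.lawFrom s) {y | ¬ p y}
  have hN : ∀ s, MeasurableSet (N s) := fun s =>
    (measurable_state 0 (measurableSet_singleton s)).inter (measurableSet_toMeasurable _ _)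
  have hB : MeasurableSet (⋃ s, N s) := MeasurableSet.iUnion hN
  have h0 : ∀ s, M.lawFrom s (⋃ s, N s) = 0 := by
    intro s
    have : M.lawFrom s (toMeasurable (M.lawFrom s) {y | ¬ p y}) = 0 := by
      rw [measure_toMeasurable]; exact hp s
    have h1 : ∀ᵐ y ∂(M.lawFrom s), y ∉ toMeasurable (M.lawFrom s) {y | ¬ p y} :=
      measure_eq_zero_iff_ae_notMem.1 this
    refine measure_eq_zero_iff_ae_notMem.2 ?_
    filter_upwards [h1, M.ae_state_zero s] with y hy hs hmem
    obtain ⟨s', hs', hy'⟩ := Set.mem_iUnion.1 hmem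
    have : s' = s := hs'.symm.trans hs
    subst this
    exact hy hy'
  have hm : M.pathLaw ρ (shift t ⁻¹' ⋃ s, N s) = 0 := by
    rw [← lintegral_indicator_one (measurable_shift t hB), M.lintegral_splice ρ t _
      (measurable_one.indicator (measurable_shift t hB))]
    have h2 : ∀ x y : Path X, (shift t ⁻¹' ⋃ s, N s).indicator (1 : Path X → ℝ≥0∞) (splice t x y) =
        (⋃ s, N s).indicator 1 y := by
      intro x y
      have h3 : splice t x y ∈ shift t ⁻¹' ⋃ s, N s ↔ y ∈ ⋃ s, N s := by
        rw [Set.mem_preimage, shift_splice]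
      by_cases hy : y ∈ ⋃ s, N s
      · rw [Set.indicator_of_mem hy, Set.indicator_of_mem (h3.2 hy), Pi.one_apply, Pi.one_apply]
      · rw [Set.indicator_of_notMem hy, Set.indicator_of_notMem (mt h3.1 hy)]
    simp_rw [h2, lintegral_indicator_one hB, h0]
    simp
  have h3 := measure_eq_zero_iff_ae_notMem.1 hm
  filter_upwards [h3] with x hx
  by_contra hpx
  refine hx (Set.mem_iUnion.2 ⟨state 0 (shift t x), rfl, ?_⟩)
  exact subset_toMeasurable _ _ hpx

/-- A weight is determined by the history before time `u` and the state at time `u`. -/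
def IsPast {β : Type*} (u : ℕ) (w : Path X → β) : Prop :=
  ∀ x y : Path X, state 0 y = state u x → w (splice u x y) = w x

/-- Splicing at `u` leaves `w` unchanged and turns `g (shift u ·)` into `g` of the fresh path, so
`w` leaves the inner integral. The reward at time `u` may not enter `w`, because splicing redraws
it. -/
theorem lintegral_past_mul (ρ : Measure X) [IsProbabilityMeasure ρ] {u : ℕ} {w g : Path X → ℝ≥0∞}
    (hw : Measurable w) (hg : Measurable g) (hp : IsPast u w) :
    ∫⁻ x, w x * g (shift u x) ∂(M.pathLaw ρ) =
      ∫⁻ x, w x * ∫⁻ y, g y ∂(M.lawFrom (state u x)) ∂(M.pathLaw ρ) := by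
  rw [M.lintegral_splice ρ u _ (by fun_prop)]
  refine lintegral_congr fun x => ?_
  rw [← lintegral_const_mul _ hg]
  refine lintegral_congr_ae ?_
  filter_upwards [M.ae_state_zero (state u x)] with y hy
  rw [hp x y hy, shift_splice]

theorem integral_past_mul (ρ : Measure X) [IsProbabilityMeasure ρ] {u : ℕ} {w g : Path X → ℝ}
    (hwg : Integrable (fun x => w x * g (shift u x)) (M.pathLaw ρ)) (hp : IsPast u w) :
    ∫ x, w x * g (shift u x) ∂(M.pathLaw ρ) =
      ∫ x, w x * ∫ y, g y ∂(M.lawFrom (state u x)) ∂(M.pathLaw ρ) := by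
  rw [M.integral_splice ρ u _ hwg]
  refine integral_congr_ae (Eventually.of_forall fun x => ?_)
  simp only
  rw [← integral_const_mul]
  refine integral_congr_ae ?_
  filter_upwards [M.ae_state_zero (state u x)] with y hy
  rw [hp x y hy, shift_splice]

end Markov

/-! ### Integrability from the effective horizon, and conditional moments of the temporal difference
error. -/

section Moments

variable {X : Type*} [MeasurableSpace X] (M : MRP X)

/-- The terminal state is absorbing along the path, and rewards are bounded by `1` and vanish at
the terminal state. -/
def Regular (x : Path X) : Prop :=
  ∀ t, (state t x = M.terminal → rew t x = 0 ∧ state (t + 1) x = M.terminal) ∧ |rew t x| ≤ 1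

/-- The number of time steps before termination. -/
noncomputable def life (x : Path X) : ℝ≥0∞ :=
  ∑' t, Set.indicator {M.terminal}ᶜ (fun _ => (1 : ℝ≥0∞)) (state t x)

/-- The indicator that the path has not terminated at time `t`. -/
noncomputable def alive (t : ℕ) (x : Path X) : ℝ :=
  Set.indicator {M.terminal}ᶜ (fun _ => (1 : ℝ)) (state t x)

/-- A regular path that terminates. -/
structure Tame (x : Path X) : Prop where
  regular : M.Regular x
  life_ne_top : M.life x ≠ ∞

variable {M}

theorem alive_of_eq {t : ℕ} {x : Path X} (h : state t x = M.terminal) : M.alive t x = 0 := by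
  simp [alive, h]

theorem alive_of_ne {t : ℕ} {x : Path X} (h : state t x ≠ M.terminal) : M.alive t x = 1 := by
  simp [alive, h]

theorem alive_nonneg (t : ℕ) (x : Path X) : 0 ≤ M.alive t x :=
  Set.indicator_nonneg (fun _ _ => zero_le_one) _

theorem Regular.stays {x : Path X} (hx : M.Regular x) {t : ℕ} (ht : state t x = M.terminal)
    {u : ℕ} (hu : t ≤ u) : x u = (M.terminal, 0) := by
  have h : state u x = M.terminal := by
    induction u, hu using Nat.le_induction with
    | base => exact ht
    | succ n _ ih => exact ((hx n).1 ih).2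
  exact Prod.ext h ((hx u).1 h).1

theorem Regular.abs_rew_le {x : Path X} (hx : M.Regular x) (t : ℕ) :
    |rew t x| ≤ M.alive t x := by
  by_cases h : state t x = M.terminal
  · rw [alive_of_eq h, ((hx t).1 h).1, abs_zero]
  · rw [alive_of_ne h]; exact (hx t).2

theorem Regular.life_le_hitTime {x : Path X} (hx : M.Regular x) : M.life x ≤ M.hitTime x := by
  refine le_iInf₂ fun t ht => ?_
  have h0 : ∀ u ∉ Finset.range t,
      Set.indicator {M.terminal}ᶜ (fun _ => (1 : ℝ≥0∞)) (state u x) = 0 := by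
    intro u hu
    have h := hx.stays ht.2 (u := u) (by simpa using hu)
    simp [state, h]
  rw [life, tsum_eq_sum h0]
  calc _ ≤ ∑ _u ∈ Finset.range t, (1 : ℝ≥0∞) :=
        Finset.sum_le_sum fun u _ => Set.indicator_le_self' (fun _ _ => zero_le_one) _
    _ = t := by simp

theorem Regular.life_eq_zero {x : Path X} (hx : M.Regular x) (h0 : state 0 x = M.terminal) :
    M.life x = 0 := by
  refine ENNReal.tsum_eq_zero.2 fun u => ?_
  have h := hx.stays h0 (u := u) (Nat.zero_le u)
  simp [state, h]

theorem Tame.exists_terminal {x : Path X} (hx : M.Tame x) :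
    ∃ T, ∀ t ≥ T, x t = (M.terminal, 0) := by
  by_cases h : ∃ T, state T x = M.terminal
  · obtain ⟨T, hT⟩ := h
    exact ⟨T, fun t ht => hx.regular.stays hT ht⟩
  · push Not at h
    refine absurd ?_ hx.life_ne_top
    have h1 : ∀ t, Set.indicator {M.terminal}ᶜ (fun _ => (1 : ℝ≥0∞)) (state t x) = 1 := by
      intro t; simp [h t]
    simp [life, h1]

theorem Tame.sum_alive_le {x : Path X} (hx : M.Tame x) (I : Finset ℕ) :
    ∑ t ∈ I, M.alive t x ≤ (M.life x).toReal := by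
  have h : ∀ t, M.alive t x =
      (Set.indicator {M.terminal}ᶜ (fun _ => (1 : ℝ≥0∞)) (state t x)).toReal := by
    intro t
    by_cases h : state t x = M.terminal <;> simp [alive, h]
  have hle : ∑ t ∈ I, Set.indicator {M.terminal}ᶜ (fun _ => (1 : ℝ≥0∞)) (state t x) ≤ M.life x :=
    ENNReal.sum_le_tsum I
  simp_rw [h]
  rw [← ENNReal.toReal_sum (fun t _ => ENNReal.ne_top_of_tsum_ne_top hx.life_ne_top t)]
  exact ENNReal.toReal_mono hx.life_ne_top hle

theorem tsum_eq_sum_range_of_terminal {β : Type*} [AddCommMonoid β] [TopologicalSpace β]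
    {f : ℕ → β} {n : ℕ} (hf : ∀ t ≥ n, f t = 0) : ∑' t, f t = ∑ t ∈ Finset.range n, f t :=
  tsum_eq_sum fun t ht => hf t (by simpa using ht)

theorem rewardToGo_eq_sum {x : Path X} {T t n : ℕ} (hT : ∀ u ≥ T, x u = (M.terminal, 0))
    (hn : T ≤ t + n) : rewardToGo t x = ∑ l ∈ Finset.range n, rew (t + l) x :=
  tsum_eq_sum_range_of_terminal fun l hl => by rw [rew, hT (t + l) (by omega)]

theorem Tame.abs_rewardToGo_le {x : Path X} (hx : M.Tame x) (t : ℕ) :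
    |rewardToGo t x| ≤ (M.life x).toReal := by
  obtain ⟨T, hT⟩ := hx.exists_terminal
  rw [rewardToGo_eq_sum hT (by omega : T ≤ t + T)]
  refine (Finset.abs_sum_le_sum_abs _ _).trans ?_
  refine (Finset.sum_le_sum fun l _ => hx.regular.abs_rew_le (t + l)).trans ?_
  have := hx.sum_alive_le ((Finset.range T).map (addLeftEmbedding t))
  simpa using this

@[fun_prop]
theorem measurable_rewardToGo (t : ℕ) : Measurable (rewardToGo t : Path X → ℝ) := by
  unfold rewardToGo
  fun_prop

@[fun_prop]
theorem measurable_life [MeasurableSingletonClass X] : Measurable (M.life : Path X → ℝ≥0∞) :=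
  Measurable.tsum fun t =>
    (measurable_const.indicator (measurableSet_singleton _).compl).comp (measurable_state t)

theorem oneStepVar_nonneg (s : X) : 0 ≤ M.oneStepVar s := variance_nonneg _ _

variable [Countable X] [MeasurableSingletonClass X]

theorem ae_regular (hRew : M.BoundedReward) (ρ : Measure X) [IsProbabilityMeasure ρ] :
    ∀ᵐ x ∂(M.pathLaw ρ), M.Regular x := by
  have h : ∀ s, ∀ᵐ y ∂(M.lawFrom s), (state 0 y = M.terminal →
      rew 0 y = 0 ∧ state 1 y = M.terminal) ∧ |rew 0 y| ≤ 1 := by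
    intro s
    have h1 : ∀ᵐ y ∂(M.lawFrom s), |rew 0 y| ≤ 1 := by
      have := hRew s
      rw [← M.map_rew_zero s] at this
      exact ae_of_ae_map (by fun_prop) this
    by_cases hs : s = M.terminal
    · have h2 : ∀ᵐ y ∂(M.lawFrom s), rew 0 y = 0 := by
        have : ∀ᵐ r ∂(M.reward s), r = 0 := by
          rw [hs, M.reward_terminal, ae_dirac_eq]; rfl
        rw [← M.map_rew_zero s] at this
        exact ae_of_ae_map (by fun_prop) this
      have h3 : ∀ᵐ y ∂(M.lawFrom s), state 1 y = M.terminal := by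
        have : ∀ᵐ r ∂(M.trans s), r = M.terminal := by
          rw [hs, M.trans_terminal, ae_dirac_eq]; rfl
        rw [← M.map_state_one s] at this
        exact ae_of_ae_map (by fun_prop) this
      filter_upwards [h1, h2, h3] with y hy1 hy2 hy3
      exact ⟨fun _ => ⟨hy2, hy3⟩, hy1⟩
    · filter_upwards [h1, M.ae_state_zero s] with y hy1 hy2
      exact ⟨fun hy => absurd (hy2.symm.trans hy) hs, hy1⟩
  have := ae_all_iff.2 fun t => M.ae_shift h ρ t
  filter_upwards [this] with x hx t
  simpa [state_shift, rew_shift] using hx t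

/-- The horizon hypothesis says nothing about the terminal state, where moreover `hitTime` cannot be
less than one. Working with `life`, which is zero there, makes the bound hold for every initial law.
-/
theorem lintegral_life_pow_le {h : ℝ} (hEff : M.EffectiveHorizon h) (hRew : M.BoundedReward)
    (ρ : Measure X) [IsProbabilityMeasure ρ] {p : ℕ} (hp : 1 ≤ p) :
    ∫⁻ x, (M.life x) ^ p ∂(M.pathLaw ρ) ≤ ENNReal.ofReal ((p * h) ^ p) := by
  have hs : ∀ s, ∫⁻ x, (M.life x) ^ p ∂(M.lawFrom s) ≤ ENNReal.ofReal ((p * h) ^ p) := by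
    intro s
    by_cases hst : s = M.terminal
    · have : ∀ᵐ x ∂(M.lawFrom s), (M.life x) ^ p = 0 := by
        filter_upwards [ae_regular hRew (Measure.dirac s), M.ae_state_zero s] with x hx h0
        rw [hx.life_eq_zero (h0.trans hst), zero_pow (by omega)]
      rw [lintegral_congr_ae this]
      simp
    · refine le_trans (lintegral_mono_ae ?_) (hEff s hst p hp)
      filter_upwards [ae_regular hRew (Measure.dirac s)] with x hx
      exact pow_le_pow_left' hx.life_le_hitTime p
  rw [M.lintegral_init ρ _ (by fun_prop)]
  calc _ ≤ ∫⁻ _x, ENNReal.ofReal ((p * h) ^ p) ∂(M.pathLaw ρ) := lintegral_mono fun x => hs _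
    _ = _ := by simp

theorem ae_tame {h : ℝ} (hEff : M.EffectiveHorizon h) (hRew : M.BoundedReward)
    (ρ : Measure X) [IsProbabilityMeasure ρ] : ∀ᵐ x ∂(M.pathLaw ρ), M.Tame x := by
  have h1 := lintegral_life_pow_le hEff hRew ρ le_rfl
  simp only [pow_one] at h1
  have h2 := ae_lt_top (by fun_prop) (h1.trans_lt ENNReal.ofReal_lt_top).ne
  filter_upwards [ae_regular hRew ρ, h2] with x hx hx2
  exact ⟨hx, hx2.ne⟩

theorem memLp_life {h : ℝ} (hEff : M.EffectiveHorizon h) (hRew : M.BoundedReward)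
    (ρ : Measure X) [IsProbabilityMeasure ρ] :
    MemLp (fun x => (M.life x).toReal) 2 (M.pathLaw ρ) := by
  refine ⟨(measurable_life.ennreal_toReal).aestronglyMeasurable, ?_⟩
  rw [eLpNorm_lt_top_iff_lintegral_rpow_enorm_lt_top (by simp) (by simp)]
  refine lt_of_le_of_lt ?_ ((lintegral_life_pow_le hEff hRew ρ one_le_two).trans_lt
    ENNReal.ofReal_lt_top)
  refine lintegral_mono fun x => ?_
  simp only [ENNReal.toReal_ofNat, ENNReal.rpow_ofNat]
  refine pow_le_pow_left' ?_ 2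
  rw [Real.enorm_eq_ofReal ENNReal.toReal_nonneg]
  exact ENNReal.ofReal_toReal_le

theorem integrable_life {h : ℝ} (hEff : M.EffectiveHorizon h) (hRew : M.BoundedReward)
    (ρ : Measure X) [IsProbabilityMeasure ρ] :
    Integrable (fun x => (M.life x).toReal) (M.pathLaw ρ) :=
  (memLp_life hEff hRew ρ).integrable one_le_two

/-- No sign is assumed for `h`; `ENNReal.ofReal` truncates at zero, hence `max h 0` here and in all
later constants. -/
theorem integral_life_le {h : ℝ} (hEff : M.EffectiveHorizon h) (hRew : M.BoundedReward)
    (ρ : Measure X) [IsProbabilityMeasure ρ] :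
    ∫ x, (M.life x).toReal ∂(M.pathLaw ρ) ≤ max h 0 := by
  have h1 := lintegral_life_pow_le hEff hRew ρ le_rfl
  simp only [pow_one, Nat.cast_one, one_mul] at h1
  rw [integral_toReal (by fun_prop)
    (ae_lt_top (by fun_prop) (h1.trans_lt ENNReal.ofReal_lt_top).ne)]
  refine (ENNReal.toReal_mono ENNReal.ofReal_ne_top h1).trans ?_
  rw [ENNReal.toReal_ofReal']

theorem integrable_rewardToGo {h : ℝ} (hEff : M.EffectiveHorizon h)
    (hRew : M.BoundedReward) (ρ : Measure X) [IsProbabilityMeasure ρ] (t : ℕ) :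
    Integrable (rewardToGo t) (M.pathLaw ρ) := by
  refine (integrable_life hEff hRew ρ).mono' (by fun_prop) ?_
  filter_upwards [ae_tame hEff hRew ρ] with x hx
  exact hx.abs_rewardToGo_le t

theorem abs_value_le {h : ℝ} (hEff : M.EffectiveHorizon h) (hRew : M.BoundedReward) (s : X) :
    |M.value s| ≤ max h 0 := by
  refine (abs_integral_le_integral_abs).trans ?_
  refine le_trans (integral_mono_ae (integrable_rewardToGo hEff hRew (Measure.dirac s) 0).abs
    (integrable_life hEff hRew (Measure.dirac s)) ?_) (integral_life_le hEff hRew (Measure.dirac s))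
  filter_upwards [ae_tame hEff hRew (Measure.dirac s)] with x hx
  exact hx.abs_rewardToGo_le 0

theorem value_terminal (hRew : M.BoundedReward) : M.value M.terminal = 0 := by
  have : ∀ᵐ x ∂(M.lawFrom M.terminal), rewardToGo 0 x = 0 := by
    filter_upwards [ae_regular hRew (Measure.dirac M.terminal), M.ae_state_zero M.terminal]
      with x hx h0
    rw [rewardToGo]
    have : ∀ l, rew (0 + l) x = 0 := fun l => by rw [rew, hx.stays h0 (Nat.zero_le _)]
    simp_rw [this, tsum_zero]
  rw [value, integral_congr_ae this]
  simp

theorem integrable_value_state {h : ℝ} (hEff : M.EffectiveHorizon h) (hRew : M.BoundedReward)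
    (ρ : Measure X) [IsProbabilityMeasure ρ] (t : ℕ) :
    Integrable (fun x => M.value (state t x)) (M.pathLaw ρ) := by
  have hm : Measurable M.value := measurable_of_countable _
  refine Integrable.of_bound (hm.comp (measurable_state t)).aestronglyMeasurable (max h 0)
    (Eventually.of_forall fun x => ?_)
  exact abs_value_le hEff hRew _

theorem ae_abs_rew_le (hRew : M.BoundedReward) (ρ : Measure X) [IsProbabilityMeasure ρ] (t : ℕ) :
    ∀ᵐ x ∂(M.pathLaw ρ), |rew t x| ≤ 1 := by
  filter_upwards [ae_regular hRew ρ] with x hx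
  exact (hx t).2

theorem integrable_rew (hRew : M.BoundedReward)
    (ρ : Measure X) [IsProbabilityMeasure ρ] (t : ℕ) :
    Integrable (rew t) (M.pathLaw ρ) :=
  Integrable.of_bound (by fun_prop) 1 (ae_abs_rew_le hRew ρ t)

/-- The Bellman equation. -/
theorem integral_rew_add_value {h : ℝ} (hEff : M.EffectiveHorizon h) (hRew : M.BoundedReward)
    (s : X) : ∫ x, (rew 0 x + M.value (state 1 x)) ∂(M.lawFrom s) = M.value s := by
  have h1 : ∀ᵐ x ∂(M.lawFrom s), rewardToGo 0 x = rew 0 x + rewardToGo 1 x := by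
    filter_upwards [ae_tame hEff hRew (Measure.dirac s)] with x hx
    obtain ⟨T, hT⟩ := hx.exists_terminal
    rw [rewardToGo_eq_sum hT (by omega : T ≤ 0 + (T + 1)),
      rewardToGo_eq_sum hT (by omega : T ≤ 1 + T), Finset.sum_range_succ', add_comm]
    simp [add_comm]
  have h2 : ∫ x, rewardToGo 1 x ∂(M.lawFrom s) = ∫ x, M.value (state 1 x) ∂(M.lawFrom s) := by
    -- The constant weight `1` puts the integrand in the form required by `integral_past_mul`.
    have h3 : rewardToGo 1 = fun x : Path X => 1 * rewardToGo 0 (shift 1 x) := by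
      ext x; simp [rewardToGo_shift]
    have h4 := integrable_rewardToGo hEff hRew (Measure.dirac s) 1
    rw [h3] at h4 ⊢
    have := M.integral_past_mul (Measure.dirac s) (u := 1) (w := fun _ => (1 : ℝ)) h4
      (fun _ _ _ => rfl)
    simpa [value, lawFrom] using this
  have i1 : Integrable (rew 0) (M.lawFrom s) := integrable_rew hRew (Measure.dirac s) 0
  have i2 : Integrable (rewardToGo 1) (M.lawFrom s) :=
    integrable_rewardToGo hEff hRew (Measure.dirac s) 1
  have i3 : Integrable (fun x => M.value (state 1 x)) (M.lawFrom s) :=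
    integrable_value_state hEff hRew (Measure.dirac s) 1
  rw [value, integral_congr_ae h1, integral_add i1 i2, h2, ← integral_add i1 i3]

variable (M) in
/-- The one-step temporal difference error `V(S₀) - R₀ - V(S₁)`. -/
noncomputable def tdError (x : Path X) : ℝ :=
  M.value (state 0 x) - rew 0 x - M.value (state 1 x)

@[fun_prop]
theorem measurable_tdError : Measurable M.tdError := by
  have hm : Measurable M.value := measurable_of_countable _
  unfold tdError
  fun_prop

theorem Regular.tdError_eq_zero {x : Path X} (hx : M.Regular x)
    (hRew : M.BoundedReward) {t : ℕ} (ht : state t x = M.terminal) :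
    M.tdError (shift t x) = 0 := by
  simp [tdError, state_shift, rew_shift, ht, ((hx t).1 ht).1, ((hx t).1 ht).2, value_terminal hRew]

/-- After termination the error vanishes, hence the factor `alive`; before it, two values cost `max
h 0` each and the reward costs `1`. Summing over time is then controlled by `life`. -/
theorem Regular.abs_tdError_le {h : ℝ} (hEff : M.EffectiveHorizon h) (hRew : M.BoundedReward)
    {x : Path X} (hx : M.Regular x) (t : ℕ) :
    |M.tdError (shift t x)| ≤ (2 * max h 0 + 1) * M.alive t x := by
  by_cases ht : state t x = M.terminal
  · simp [hx.tdError_eq_zero hRew ht, alive_of_eq ht]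
  · rw [alive_of_ne ht, mul_one, tdError]
    have h1 := abs_value_le hEff hRew (state 0 (shift t x))
    have h2 := abs_value_le hEff hRew (state 1 (shift t x))
    have h3 : |rew 0 (shift t x)| ≤ 1 := (hx t).2
    rw [abs_le] at *
    constructor <;> linarith

theorem integral_tdError {h : ℝ} (hEff : M.EffectiveHorizon h) (hRew : M.BoundedReward) (s : X) :
    ∫ x, M.tdError x ∂(M.lawFrom s) = 0 := by
  have h1 : ∀ᵐ x ∂(M.lawFrom s), M.tdError x = M.value s - (rew 0 x + M.value (state 1 x)) := by
    filter_upwards [M.ae_state_zero s] with x hx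
    rw [tdError, hx]; ring
  rw [integral_congr_ae h1, integral_sub (integrable_const _), integral_rew_add_value hEff hRew]
  · simp
  · exact (integrable_rew hRew (Measure.dirac s) 0).add
      (integrable_value_state hEff hRew (Measure.dirac s) 1)

theorem integral_tdError_sq {h : ℝ} (hEff : M.EffectiveHorizon h) (hRew : M.BoundedReward)
    (s : X) : ∫ x, M.tdError x ^ 2 ∂(M.lawFrom s) = M.oneStepVar s := by
  have hm : Measurable M.value := measurable_of_countable _
  rw [oneStepVar, variance_eq_integral (by fun_prop), integral_rew_add_value hEff hRew]
  refine integral_congr_ae ?_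
  filter_upwards [M.ae_state_zero s] with x hx
  rw [tdError, hx]; ring

theorem memLp_rew_add_value {h : ℝ} (hEff : M.EffectiveHorizon h) (hRew : M.BoundedReward)
    (s : X) : MemLp (fun x => rew 0 x + M.value (state 1 x)) 2 (M.lawFrom s) := by
  have hm : Measurable M.value := measurable_of_countable _
  refine MemLp.of_bound (by fun_prop) (1 + max h 0) ?_
  filter_upwards [ae_abs_rew_le hRew (Measure.dirac s) 0] with x hx
  exact (abs_add_le _ _).trans (add_le_add hx (abs_value_le hEff hRew _))

theorem oneStepVar_terminal {h : ℝ} (hEff : M.EffectiveHorizon h) (hRew : M.BoundedReward) :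
    M.oneStepVar M.terminal = 0 := by
  rw [← integral_tdError_sq hEff hRew]
  have : ∀ᵐ x ∂(M.lawFrom M.terminal), M.tdError x ^ 2 = 0 := by
    filter_upwards [ae_regular hRew (Measure.dirac M.terminal), M.ae_state_zero M.terminal]
      with x hx h0
    have := hx.tdError_eq_zero hRew h0
    have h : shift 0 x = x := by ext k : 1; simp [shift]
    rw [h] at this
    rw [this]; simp
  rw [integral_congr_ae this]
  simp

theorem oneStepVar_le {h : ℝ} (hEff : M.EffectiveHorizon h) (hRew : M.BoundedReward) (s : X) :
    M.oneStepVar s ≤ (2 * max h 0 + 1) ^ 2 := by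
  have hb : ∀ᵐ x ∂(M.lawFrom s), |M.tdError x| ≤ 2 * max h 0 + 1 := by
    filter_upwards [ae_regular hRew (Measure.dirac s)] with x hx
    rw [tdError]
    have h1 := abs_value_le hEff hRew (state 0 x)
    have h2 := abs_value_le hEff hRew (state 1 x)
    have h3 : |rew 0 x| ≤ 1 := (hx 0).2
    rw [abs_le] at *
    constructor <;> linarith
  have hle : ∀ᵐ x ∂(M.lawFrom s), M.tdError x ^ 2 ≤ (2 * max h 0 + 1) ^ 2 := by
    filter_upwards [hb] with x hx
    exact sq_le_sq' (abs_le.1 hx).1 (abs_le.1 hx).2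
  rw [← integral_tdError_sq hEff hRew]
  refine le_trans (integral_mono_of_nonneg (Eventually.of_forall fun x => sq_nonneg _)
    (integrable_const _) hle) ?_
  simp

theorem oneStepVar_state_le {h : ℝ} (hEff : M.EffectiveHorizon h) (hRew : M.BoundedReward)
    (t : ℕ) (x : Path X) :
    M.oneStepVar (state t x) ≤ (2 * max h 0 + 1) ^ 2 * M.alive t x := by
  by_cases ht : state t x = M.terminal
  · rw [ht, oneStepVar_terminal hEff hRew, alive_of_eq ht, mul_zero]
  · rw [alive_of_ne ht, mul_one]
    exact oneStepVar_le hEff hRew _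

end Moments

end MRP

namespace MRP

/-! ### The score as a martingale transform of temporal difference errors. -/

section Score

variable {X : Type*} [DecidableEq X] (G : Finset X)

/-- The weight of the temporal difference error at time `u` in the score of `s`: the number of
reasons (a visit to `s` at time `u`, or an earlier exit from `G` at `s`) for which it counts. -/
noncomputable def coef (s : X) (u : ℕ) (x : Path X) : ℝ :=
  (if state u x = s then 1 else 0) +
    ∑ t ∈ Finset.range u, if state t x = s ∧ state (t + 1) x ∉ G then 1 else 0

/-- After leaving `G` the path never comes back to `G`. -/
def LeavesOnce (x : Path X) : Prop :=
  ∀ t, state t x ∈ G → state (t + 1) x ∉ G → ∀ k ≥ t + 1, state k x ∉ G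

omit [DecidableEq X] in
theorem state_splice {t u : ℕ} (htu : t ≤ u) {x y : Path X} (hy : state 0 y = state u x) :
    state t (splice u x y) = state t x := by
  rcases htu.lt_or_eq with h | rfl
  · simp [state, splice, h]
  · simpa [state, splice] using hy

omit [DecidableEq X] in
theorem rew_splice {t u : ℕ} (htu : t < u) (x y : Path X) :
    rew t (splice u x y) = rew t x := by
  simp [rew, splice, htu]

variable {G}

theorem isPast_coef (s : X) (u : ℕ) : IsPast u (coef G s u) := by
  intro x y hy
  rw [coef, coef, state_splice le_rfl hy]
  congr 1
  refine Finset.sum_congr rfl fun t ht => ?_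
  rw [Finset.mem_range] at ht
  rw [state_splice ht.le hy, state_splice (Nat.succ_le_of_lt ht) hy]

/-- A path that leaves `G` at most once is, at time `u`, either still in `G` with no earlier exit,
or outside with at most one earlier exit, made from a single state. So the weights are indicators of
events that are disjoint for different states of `G`. -/
theorem LeavesOnce.coef_mul_coef {x : Path X} (hx : LeavesOnce G x) {s s' : X} (hs : s ∈ G)
    (hs' : s' ∈ G) (u : ℕ) :
    coef G s u x * coef G s' u x = if s = s' then coef G s u x else 0 := by
  -- A visit to `G` at time `u` excludes an earlier exit.
  have h1 : ∀ (a b : X), a ∈ G → b ∈ G → ∀ t ∈ Finset.range u,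
      (if state u x = a then (1 : ℝ) else 0) *
        (if state t x = b ∧ state (t + 1) x ∉ G then 1 else 0) = 0 := by
    intro a b ha hb t ht
    rw [Finset.mem_range] at ht
    split_ifs with h1 h2
    · exact absurd (h1 ▸ ha) (hx t (h2.1 ▸ hb) h2.2 u ht)
    all_goals simp
  -- Two exits at different times exclude each other, so only the terms `t = t'` survive below.
  have h2 : ∀ t t', t < t' → ∀ (a b : X), a ∈ G → b ∈ G →
      (if state t x = a ∧ state (t + 1) x ∉ G then (1 : ℝ) else 0) *
        (if state t' x = b ∧ state (t' + 1) x ∉ G then 1 else 0) = 0 := by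
    intro t t' htt a b ha hb
    split_ifs with h1 h2
    · exact absurd (h2.1 ▸ hb) (hx t (h1.1 ▸ ha) h1.2 t' htt)
    all_goals simp
  have h3 : ∀ t ∈ Finset.range u, ∑ t' ∈ Finset.range u,
      (if state t x = s ∧ state (t + 1) x ∉ G then (1 : ℝ) else 0) *
        (if state t' x = s' ∧ state (t' + 1) x ∉ G then 1 else 0) =
      if s = s' then (if state t x = s ∧ state (t + 1) x ∉ G then (1 : ℝ) else 0) else 0 := by
    intro t ht
    rw [Finset.sum_eq_single_of_mem t ht]
    · by_cases h : s = s'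
      · subst h
        rw [if_pos rfl]
        split_ifs <;> simp
      · rw [if_neg h]
        split_ifs with h4 h5
        · exact absurd (h4.1.symm.trans h5.1) h
        all_goals simp
    · intro t' _ hne
      rcases lt_or_gt_of_ne hne with h | h
      · rw [mul_comm]; exact h2 t' t h s' s hs' hs
      · exact h2 t t' h s s' hs hs'
  rw [coef, coef, add_mul, mul_add, mul_add, Finset.mul_sum, Finset.sum_mul,
    Finset.sum_eq_zero (h1 s s' hs hs'), Finset.sum_mul_sum, Finset.sum_congr rfl h3]
  rw [Finset.sum_eq_zero (fun t ht => by rw [mul_comm]; exact h1 s' s hs' hs t ht)]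
  by_cases h : s = s'
  · subst h; simp
  · simp only [if_neg h, Finset.sum_const_zero, add_zero]
    split_ifs with h4 h5
    · exact absurd (h4.symm.trans h5) h
    all_goals simp

theorem coef_nonneg (s : X) (u : ℕ) (x : Path X) : 0 ≤ coef G s u x := by
  unfold coef
  positivity

theorem LeavesOnce.coef_le_one {x : Path X} (hx : LeavesOnce G x) {s : X} (hs : s ∈ G) (u : ℕ) :
    coef G s u x ≤ 1 := by
  have h := hx.coef_mul_coef hs hs u
  rw [if_pos rfl] at h
  -- The weight is idempotent, and `c² = c` with `(c - 1)² ≥ 0` gives `c ≤ 1`.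
  nlinarith [sq_nonneg (coef G s u x - 1)]

/-- Crude, but free of transience: for fixed `u` the weight is bounded, which makes every product in
the martingale computation integrable. -/
theorem coef_le (s : X) (u : ℕ) (x : Path X) : coef G s u x ≤ 1 + u := by
  unfold coef
  refine add_le_add (by split_ifs <;> simp) ?_
  calc _ ≤ ∑ _t ∈ Finset.range u, (1 : ℝ) := Finset.sum_le_sum fun t _ => by split_ifs <;> simp
    _ = u := by simp

variable [MeasurableSpace X]

@[fun_prop]
theorem measurable_coef [MeasurableSingletonClass X] (s : X) (u : ℕ) : Measurable (coef G s u) := by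
  have h1 : ∀ t, MeasurableSet {x : Path X | state t x = s} := fun t =>
    measurable_state t (measurableSet_singleton s)
  have h2 : ∀ t, MeasurableSet {x : Path X | state t x ∉ G} := fun t =>
    measurable_state t (G.measurableSet.compl)
  unfold coef
  refine Measurable.add (Measurable.ite (h1 u) measurable_const measurable_const) ?_
  exact Finset.measurable_fun_sum _ fun t _ =>
    Measurable.ite ((h1 t).inter (h2 (t + 1))) measurable_const measurable_const

variable (M : MRP X)

theorem tdTerm_eq (s : X) (t : ℕ) (x : Path X) :
    M.tdTerm s t x = (if state t x = s then 1 else 0) * M.tdError (shift t x) := by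
  rw [tdTerm, tdError, state_shift, state_shift, rew_shift]
  split_ifs with h
  · simp [h]
  · simp

variable (G) in
/-- The score truncated at time `n`, as a martingale transform. -/
noncomputable def partialScore (s : X) (n : ℕ) (x : Path X) : ℝ :=
  ∑ u ∈ Finset.range n, coef G s u x * M.tdError (shift u x)

variable {M}

/-- The errors before time `n` involve rewards up to `n - 1` and states up to `n`, exactly what
splicing at `n` preserves. -/
theorem isPast_partialScore (s : X) (n : ℕ) : IsPast n (M.partialScore G s n) := by
  intro x y hy
  refine Finset.sum_congr rfl fun u hu => ?_
  rw [Finset.mem_range] at hu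
  congr 1
  · unfold coef
    rw [state_splice hu.le hy]
    congr 1
    refine Finset.sum_congr rfl fun t ht => ?_
    rw [Finset.mem_range] at ht
    rw [state_splice (ht.trans hu).le hy, state_splice (by omega) hy]
  · simp only [tdError, state_shift, rew_shift, add_zero]
    rw [state_splice hu.le hy, state_splice (by omega) hy, rew_splice hu]

variable [MeasurableSingletonClass X]

omit [DecidableEq X] in
-- Telescoping: each `tdError` replaces one step of reward by a difference of values, and both the
-- value and the remaining reward vanish after termination.
theorem value_sub_rewardToGo_eq_sum [Countable X] (hRew : M.BoundedReward) {x : Path X} {T : ℕ}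
    (hT : ∀ t ≥ T, x t = (M.terminal, 0)) {m n : ℕ} (hmn : m ≤ n) (hn : T ≤ n) :
    M.value (state m x) - rewardToGo m x =
      ∑ u ∈ Finset.Ico m n, M.tdError (shift u x) := by
  induction hmn using Nat.decreasingInduction with
  | self =>
    have h1 : rewardToGo n x = 0 := by
      rw [rewardToGo_eq_sum hT (n := 0) (by omega)]; simp
    rw [h1, state, hT n hn, value_terminal hRew]
    simp
  | of_succ m hm ih =>
    rw [Finset.sum_eq_sum_Ico_succ_bot hm, ← ih,
      rewardToGo_eq_sum hT (t := m) (n := T + 1) (by omega),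
      rewardToGo_eq_sum hT (t := m + 1) (n := T) (by omega), Finset.sum_range_succ', tdError,
      state_shift, state_shift, rew_shift]
    simp only [add_zero, add_assoc, add_comm 1]
    ring

theorem score_eq_sum [Countable X] (hRew : M.BoundedReward) (hterm : M.terminal ∉ G) {s : X}
    (hs : s ∈ G) {x : Path X} {T n : ℕ} (hT : ∀ t ≥ T, x t = (M.terminal, 0)) (hn : T ≤ n) :
    M.score G s x = ∑ u ∈ Finset.range n, coef G s u x * M.tdError (shift u x) := by
  have hst : ∀ t ≥ T, state t x ≠ s := by
    intro t ht h
    rw [state, hT t ht] at h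
    exact hterm (by rwa [show M.terminal = s from h])
  rw [score, tsum_eq_sum_range_of_terminal (n := n)]
  · simp only [coef, add_mul, Finset.sum_add_distrib, tdTerm_eq]
    congr 1
    have h1 : ∀ t ∈ Finset.range n, M.mcTerm G s t x = ∑ u ∈ Finset.Ico (t + 1) n,
        (if state t x = s ∧ state (t + 1) x ∉ G then 1 else 0) * M.tdError (shift u x) := by
      intro t ht
      rw [← Finset.mul_sum, ← value_sub_rewardToGo_eq_sum hRew hT
        (Nat.succ_le_of_lt (Finset.mem_range.1 ht)) hn, mcTerm]
      split_ifs <;> simp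
    -- Exchanging the exit time `t` with the later time `u` collects, for each `u`, the number of
    -- earlier exits from `s`, which is the second part of `coef`.
    rw [Finset.sum_congr rfl h1, Finset.range_eq_Ico, Finset.sum_Ico_Ico_comm']
    simp only [Finset.sum_mul, Finset.range_eq_Ico]
  · intro t ht
    have := hst t (hn.trans ht)
    simp [tdTerm, mcTerm, this]

end Score

/-! ### Orthogonality of the scores of different states. -/

section Covariance

variable {X : Type*} [Countable X] [DecidableEq X] [MeasurableSpace X]
  [MeasurableSingletonClass X] {M : MRP X} {h : ℝ} {G : Finset X}

/-- The hypothesis concerns a chain that starts in `G` at time `0`; the Markov property carries it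
to every time and every initial law. -/
theorem ae_leavesOnce (hG : M.IsTransient G) (ρ : Measure X) [IsProbabilityMeasure ρ] :
    ∀ᵐ x ∂(M.pathLaw ρ), LeavesOnce G x := by
  have h1 : ∀ s, ∀ᵐ y ∂(M.lawFrom s), state 0 y ∈ G → state 1 y ∉ G → ∀ k ≥ 1, state k y ∉ G := by
    intro s
    by_cases hs : s ∈ G
    · have h2 : ∀ k : ℕ, ∀ᵐ y ∂(M.lawFrom s), 1 ≤ k → ¬ (state 1 y ∉ G ∧ state k y ∈ G) := by
        intro k
        by_cases hk : 1 ≤ k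
        · filter_upwards [measure_eq_zero_iff_ae_notMem.1 (hG s hs k hk)] with y hy _
          exact hy
        · exact Eventually.of_forall fun y hk' => absurd hk' hk
      filter_upwards [ae_all_iff.2 h2] with y hy _ h1 k hk hmem
      exact hy k hk ⟨h1, hmem⟩
    · filter_upwards [M.ae_state_zero s] with y hy h0
      exact absurd (hy ▸ h0) hs
  filter_upwards [ae_all_iff.2 fun t => M.ae_shift h1 ρ t] with x hx t h0 h1 k hk
  have := hx t (by simpa [state_shift] using h0) (by simpa [state_shift] using h1) (k - t)
    (by omega)
  rwa [state_shift, Nat.add_sub_cancel' (by omega)] at this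

omit [Countable X] in
theorem memLp_coef (ρ : Measure X) [IsProbabilityMeasure ρ] (s : X) (u : ℕ) :
    MemLp (coef G s u) ∞ (M.pathLaw ρ) := by
  refine memLp_top_of_bound (by fun_prop) (1 + u) (Eventually.of_forall fun x => ?_)
  rw [Real.norm_eq_abs, abs_of_nonneg (coef_nonneg s u x)]
  exact coef_le s u x

theorem memLp_tdError_shift (hEff : M.EffectiveHorizon h) (hRew : M.BoundedReward) (ρ : Measure X)
    [IsProbabilityMeasure ρ] (u : ℕ) :
    MemLp (fun x => M.tdError (shift u x)) ∞ (M.pathLaw ρ) := by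
  refine memLp_top_of_bound (measurable_tdError.comp (measurable_shift u)).aestronglyMeasurable (2 * max h 0 + 1) ?_
  filter_upwards [ae_regular hRew ρ] with x hx
  refine (hx.abs_tdError_le hEff hRew u).trans (mul_le_of_le_one_right (by positivity) ?_)
  by_cases ht : state u x = M.terminal
  · rw [alive_of_eq ht]; exact zero_le_one
  · rw [alive_of_ne ht]

theorem memLp_partialScore (hEff : M.EffectiveHorizon h) (hRew : M.BoundedReward) (ρ : Measure X)
    [IsProbabilityMeasure ρ] (s : X) (n : ℕ) : MemLp (M.partialScore G s n) ∞ (M.pathLaw ρ) :=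
  memLp_finsetSum _ fun u _ =>
    (memLp_tdError_shift hEff hRew ρ u).mul (memLp_coef ρ s u) (r := ∞)

theorem integral_partialScore (hEff : M.EffectiveHorizon h) (hRew : M.BoundedReward) (ρ : Measure X)
    [IsProbabilityMeasure ρ] (s : X) (n : ℕ) :
    ∫ x, M.partialScore G s n x ∂(M.pathLaw ρ) = 0 := by
  have hi : ∀ u, Integrable (fun x => coef G s u x * M.tdError (shift u x)) (M.pathLaw ρ) :=
    fun u => ((memLp_tdError_shift hEff hRew ρ u).mul (memLp_coef ρ s u) (r := ∞)).integrable le_top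
  unfold partialScore
  rw [integral_finsetSum _ fun u _ => hi u]
  refine Finset.sum_eq_zero fun u _ => ?_
  rw [M.integral_past_mul ρ (hi u) (isPast_coef s u)]
  simp [integral_tdError hEff hRew]

/-- Orthogonality of martingale increments, by induction on `n`: the newest error is centered given
the past, which kills both cross terms, and its conditional second moment is the one-step variance.
Transience plays no role yet. -/
theorem integral_partialScore_mul (hEff : M.EffectiveHorizon h) (hRew : M.BoundedReward)
    (ρ : Measure X) [IsProbabilityMeasure ρ] (s s' : X) (n : ℕ) :
    ∫ x, M.partialScore G s n x * M.partialScore G s' n x ∂(M.pathLaw ρ) =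
      ∑ u ∈ Finset.range n,
        ∫ x, coef G s u x * coef G s' u x * M.oneStepVar (state u x) ∂(M.pathLaw ρ) := by
  induction n with
  | zero => simp [partialScore]
  | succ n ih =>
    have hd := memLp_tdError_shift hEff hRew ρ n
    have hp : ∀ a, MemLp (M.partialScore G a n) ∞ (M.pathLaw ρ) := fun a =>
      memLp_partialScore hEff hRew ρ a n
    have hc : ∀ a, MemLp (coef G a n) ∞ (M.pathLaw ρ) := fun a => memLp_coef ρ a n
    have hcross : ∀ a b, Integrable (fun x => (M.partialScore G a n x * coef G b n x) *
        M.tdError (shift n x)) (M.pathLaw ρ) := fun a b =>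
      (hd.mul ((hc b).mul (hp a) (r := ∞)) (r := ∞)).integrable le_top
    have hsq : Integrable (fun x => (coef G s n x * coef G s' n x) *
        (M.tdError (shift n x)) ^ 2) (M.pathLaw ρ) := by
      have := ((hd.mul hd (r := ∞)).mul ((hc s').mul (hc s) (r := ∞)) (r := ∞)).integrable le_top
      refine this.congr (Eventually.of_forall fun x => ?_)
      simp only [Pi.mul_apply, sq]
    have hpp : Integrable (fun x => M.partialScore G s n x * M.partialScore G s' n x)
        (M.pathLaw ρ) := ((hp s').mul (hp s) (r := ∞)).integrable le_top
    have hzero : ∀ a b, ∫ x, (M.partialScore G a n x * coef G b n x) *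
        M.tdError (shift n x) ∂(M.pathLaw ρ) = 0 := by
      intro a b
      rw [M.integral_past_mul ρ (hcross a b) (fun x y hy => by
        rw [isPast_partialScore a n x y hy, isPast_coef b n x y hy])]
      simp [integral_tdError hEff hRew]
    have hsq' := M.integral_past_mul ρ (u := n) (w := fun x => coef G s n x * coef G s' n x)
      (g := fun y => M.tdError y ^ 2) hsq (fun x y hy => by
        simp only [isPast_coef s n x y hy, isPast_coef s' n x y hy])
    simp only [integral_tdError_sq hEff hRew] at hsq'
    have hexp : ∀ x, M.partialScore G s (n + 1) x * M.partialScore G s' (n + 1) x =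
        M.partialScore G s n x * M.partialScore G s' n x +
        (M.partialScore G s n x * coef G s' n x) * M.tdError (shift n x) +
        (M.partialScore G s' n x * coef G s n x) * M.tdError (shift n x) +
        (coef G s n x * coef G s' n x) * (M.tdError (shift n x)) ^ 2 := by
      intro x
      simp only [partialScore, Finset.sum_range_succ]
      ring
    have i1 := hpp.fun_add (hcross s s')
    have i2 := i1.fun_add (hcross s' s)
    simp_rw [hexp]
    rw [integral_add i2 hsq, integral_add i1 (hcross s' s), integral_add hpp (hcross s s'), hzero, hzero, ih, hsq', Finset.sum_range_succ]
    ring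

/-- The bound is uniform in `n` because transience caps the weights by `1`; with `coef_le` alone it
would grow with `u`. It is the dominating function for all limits below. -/
theorem abs_partialScore_le (hEff : M.EffectiveHorizon h) (hRew : M.BoundedReward)
    {x : Path X} (hx : M.Tame x) (hl : LeavesOnce G x) {s : X} (hs : s ∈ G) (n : ℕ) :
    |M.partialScore G s n x| ≤ (2 * max h 0 + 1) * (M.life x).toReal := by
  refine (Finset.abs_sum_le_sum_abs _ _).trans ?_
  refine le_trans ?_ (mul_le_mul_of_nonneg_left (hx.sum_alive_le (Finset.range n))
    (by positivity))
  rw [Finset.mul_sum]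
  refine Finset.sum_le_sum fun u _ => ?_
  rw [abs_mul, abs_of_nonneg (coef_nonneg s u x)]
  exact (mul_le_of_le_one_left (abs_nonneg _) (hl.coef_le_one hs u)).trans
    (hx.regular.abs_tdError_le hEff hRew u)

theorem Tame.tendsto_partialScore (hRew : M.BoundedReward) (hterm : M.terminal ∉ G)
    {x : Path X} (hx : M.Tame x) {s : X} (hs : s ∈ G) :
    Tendsto (fun n => M.partialScore G s n x) atTop (𝓝 (M.score G s x)) := by
  obtain ⟨T, hT⟩ := hx.exists_terminal
  refine tendsto_const_nhds.congr' ?_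
  filter_upwards [eventually_ge_atTop T] with n hn
  exact score_eq_sum hRew hterm hs hT hn

theorem abs_score_le (hEff : M.EffectiveHorizon h) (hRew : M.BoundedReward)
    (hterm : M.terminal ∉ G) {x : Path X} (hx : M.Tame x) (hl : LeavesOnce G x) {s : X}
    (hs : s ∈ G) : |M.score G s x| ≤ (2 * max h 0 + 1) * (M.life x).toReal :=
  le_of_tendsto (hx.tendsto_partialScore hRew hterm hs).abs
    (Eventually.of_forall fun n => abs_partialScore_le hEff hRew hx hl hs n)

@[fun_prop]
theorem measurable_score (s : X) : Measurable (M.score G s) := by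
  have hm : Measurable M.value := measurable_of_countable _
  have h1 : ∀ t, MeasurableSet {x : Path X | state t x = s} := fun t =>
    measurable_state t (measurableSet_singleton s)
  have h2 : ∀ t, MeasurableSet {x : Path X | state t x ∉ G} := fun t =>
    measurable_state t (G.measurableSet.compl)
  refine Measurable.tsum fun t => Measurable.add ?_ ?_
  · exact Measurable.ite (h1 t) (by fun_prop) measurable_const
  · exact Measurable.ite ((h1 t).inter (h2 (t + 1))) (by fun_prop) measurable_const

theorem memLp_score (hEff : M.EffectiveHorizon h) (hRew : M.BoundedReward)
    (hterm : M.terminal ∉ G) (hG : M.IsTransient G) (ρ : Measure X) [IsProbabilityMeasure ρ]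
    {s : X} (hs : s ∈ G) : MemLp (M.score G s) 2 (M.pathLaw ρ) := by
  refine ((memLp_life hEff hRew ρ).const_mul (2 * max h 0 + 1)).mono'
    (measurable_score s).aestronglyMeasurable ?_
  filter_upwards [ae_tame hEff hRew ρ, ae_leavesOnce hG ρ] with x hx hl
  exact abs_score_le hEff hRew hterm hx hl hs

theorem integral_score (hEff : M.EffectiveHorizon h) (hRew : M.BoundedReward)
    (hterm : M.terminal ∉ G) (hG : M.IsTransient G) (ρ : Measure X) [IsProbabilityMeasure ρ]
    {s : X} (hs : s ∈ G) : ∫ x, M.score G s x ∂(M.pathLaw ρ) = 0 := by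
  have h1 : Tendsto (fun n => ∫ x, M.partialScore G s n x ∂(M.pathLaw ρ)) atTop
      (𝓝 (∫ x, M.score G s x ∂(M.pathLaw ρ))) := by
    refine tendsto_integral_of_dominated_convergence
      (fun x => (2 * max h 0 + 1) * (M.life x).toReal)
      (fun n => (memLp_partialScore hEff hRew ρ s n).1)
      ((integrable_life hEff hRew ρ).const_mul _) (fun n => ?_) ?_
    · filter_upwards [ae_tame hEff hRew ρ, ae_leavesOnce hG ρ] with x hx hl
      exact abs_partialScore_le hEff hRew hx hl hs n
    · filter_upwards [ae_tame hEff hRew ρ] with x hx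
      exact hx.tendsto_partialScore hRew hterm hs
  simp_rw [integral_partialScore hEff hRew] at h1
  exact tendsto_nhds_unique h1 tendsto_const_nhds

/-- Dominated convergence with a multiple of the square of `life`, integrable by the horizon bound
with `p = 2`. -/
theorem tendsto_sum_integral_coef (hEff : M.EffectiveHorizon h) (hRew : M.BoundedReward)
    (hterm : M.terminal ∉ G) (hG : M.IsTransient G) (ρ : Measure X) [IsProbabilityMeasure ρ]
    {s s' : X} (hs : s ∈ G) (hs' : s' ∈ G) :
    Tendsto (fun n => ∑ u ∈ Finset.range n,
      ∫ x, coef G s u x * coef G s' u x * M.oneStepVar (state u x) ∂(M.pathLaw ρ)) atTop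
      (𝓝 (∫ x, M.score G s x * M.score G s' x ∂(M.pathLaw ρ))) := by
  simp_rw [← integral_partialScore_mul hEff hRew]
  refine tendsto_integral_of_dominated_convergence
    (fun x => ((2 * max h 0 + 1) * (M.life x).toReal) ^ 2)
    (fun n => (memLp_partialScore hEff hRew ρ s n).1.mul (memLp_partialScore hEff hRew ρ s' n).1)
    ((memLp_life hEff hRew ρ).const_mul _).integrable_sq (fun n => ?_) ?_
  · filter_upwards [ae_tame hEff hRew ρ, ae_leavesOnce hG ρ] with x hx hl
    rw [Real.norm_eq_abs, abs_mul, sq]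
    exact mul_le_mul (abs_partialScore_le hEff hRew hx hl hs n)
      (abs_partialScore_le hEff hRew hx hl hs' n) (abs_nonneg _)
      ((abs_nonneg _).trans (abs_partialScore_le hEff hRew hx hl hs n))
  · filter_upwards [ae_tame hEff hRew ρ] with x hx
    exact (hx.tendsto_partialScore hRew hterm hs).mul (hx.tendsto_partialScore hRew hterm hs')

theorem integral_score_mul_of_ne (hEff : M.EffectiveHorizon h) (hRew : M.BoundedReward)
    (hterm : M.terminal ∉ G) (hG : M.IsTransient G) (ρ : Measure X) [IsProbabilityMeasure ρ]
    {s s' : X} (hs : s ∈ G) (hs' : s' ∈ G) (hne : s ≠ s') :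
    ∫ x, M.score G s x * M.score G s' x ∂(M.pathLaw ρ) = 0 := by
  refine tendsto_nhds_unique (tendsto_sum_integral_coef hEff hRew hterm hG ρ hs hs')
    (tendsto_const_nhds.congr fun n => (Finset.sum_eq_zero fun u _ => ?_).symm)
  refine integral_eq_zero_of_ae ?_
  filter_upwards [ae_leavesOnce hG ρ] with x hl
  simp [hl.coef_mul_coef hs hs', hne]

end Covariance

end MRP

/-! ### Occupation identities, the diagonal of the covariance, and the inverse of `1 - P_G`. -/

namespace MRP

theorem tsum_ite_lt (t : ℕ) (a : ℕ → ℝ≥0∞) :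
    ∑' u, (if t < u then a u else 0) = ∑' k, a (t + 1 + k) := by
  have h := (ENNReal.summable (f := fun k => if t < k + (t + 1) then a (k + (t + 1)) else
    0)).sum_add_tsum_nat_add' (f := fun u => if t < u then a u else 0)
  rw [← h, Finset.sum_eq_zero, zero_add]
  · refine tsum_congr fun k => ?_
    rw [if_pos (by omega), add_comm]
  · intro u hu
    rw [if_neg (by simpa [Nat.lt_succ_iff] using hu)]

section Occupation

variable {X : Type*} [Countable X] [DecidableEq X] [MeasurableSpace X]
  [MeasurableSingletonClass X] {M : MRP X} {h : ℝ} {G : Finset X}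

variable (M) in
/-- The expected sum of a functional over all sub-trajectories started at `s`. -/
theorem lintegral_tsum_visits (ρ : Measure X) [IsProbabilityMeasure ρ] (s : X) {g : Path X → ℝ≥0∞}
    (hg : Measurable g) :
    ∫⁻ x, ∑' t, (if state t x = s then g (shift t x) else 0) ∂(M.pathLaw ρ) =
      (∑' t, M.pathLaw ρ {x | state t x = s}) * ∫⁻ y, g y ∂(M.lawFrom s) := by
  have h1 : ∀ t, MeasurableSet {x : Path X | state t x = s} := fun t =>
    measurable_state t (measurableSet_singleton s)
  rw [lintegral_tsum fun t => (Measurable.ite (h1 t) (by fun_prop) measurable_const).aemeasurable,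
    ← ENNReal.tsum_mul_right]
  refine tsum_congr fun t => ?_
  have h2 := M.lintegral_past_mul ρ (u := t) (w := {x | state t x = s}.indicator 1) (g := g)
    (measurable_one.indicator (h1 t)) hg (fun x y hy => by
      simp only [Set.indicator, Set.mem_ofPred_eq, state_splice le_rfl hy, Pi.one_apply])
  have h3 : ∀ x : Path X, (if state t x = s then g (shift t x) else 0) =
      {x | state t x = s}.indicator 1 x * g (shift t x) := by
    intro x
    by_cases hx : state t x = s <;> simp [hx]
  have h4 : ∀ x : Path X, ({x | state t x = s}.indicator 1 x : ℝ≥0∞) *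
      ∫⁻ y, g y ∂(M.lawFrom (state t x)) =
      {x | state t x = s}.indicator 1 x * ∫⁻ y, g y ∂(M.lawFrom s) := by
    intro x
    by_cases hx : state t x = s <;> simp [hx]
  simp_rw [h3]
  rw [h2]
  simp_rw [h4]
  rw [lintegral_mul_const _ (measurable_one.indicator (h1 t)), lintegral_indicator_one (h1 t)]

variable (M) in
theorem lintegral_visits (ρ : Measure X) [IsProbabilityMeasure ρ] (s : X) :
    ∫⁻ x, visits s x ∂(M.pathLaw ρ) = ∑' t, M.pathLaw ρ {x | state t x = s} := by
  have := M.lintegral_tsum_visits ρ s (g := fun _ => 1) measurable_const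
  simpa [visits] using this

omit [Countable X] [MeasurableSingletonClass X] in
theorem visits_le_life {s : X} (hs : s ≠ M.terminal) (x : Path X) : visits s x ≤ M.life x := by
  refine ENNReal.tsum_le_tsum fun t => ?_
  split_ifs with hx
  · simp [hx, hs]
  · exact zero_le

theorem lintegral_visits_lt_top (hEff : M.EffectiveHorizon h) (hRew : M.BoundedReward)
    (ρ : Measure X) [IsProbabilityMeasure ρ] {s : X} (hs : s ≠ M.terminal) :
    ∫⁻ x, visits s x ∂(M.pathLaw ρ) < ∞ := by
  have h1 := lintegral_life_pow_le hEff hRew ρ le_rfl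
  simp only [pow_one] at h1
  exact ((lintegral_mono fun x => visits_le_life hs x).trans h1).trans_lt ENNReal.ofReal_lt_top

theorem occupancy_lt_top (hEff : M.EffectiveHorizon h) (hRew : M.BoundedReward)
    {s : X} (hs : s ≠ M.terminal) : M.occupancy s < ∞ := by
  rw [occupancy, ← lintegral_visits]
  exact lintegral_visits_lt_top hEff hRew M.init hs

theorem expectedVisits_lt_top (hEff : M.EffectiveHorizon h) (hRew : M.BoundedReward)
    (s : X) {s' : X} (hs : s' ≠ M.terminal) : M.expectedVisits s s' < ∞ :=
  lintegral_visits_lt_top hEff hRew (Measure.dirac s) hs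

variable (M G) in
/-- The conditional variance accumulated by one visit: the one-step variance and, after an exit
from `G`, all later one-step variances. -/
noncomputable def visitVar (y : Path X) : ℝ≥0∞ :=
  ENNReal.ofReal (M.oneStepVar (state 0 y)) +
    {y | state 1 y ∉ G}.indicator
      (fun y => ∑' k : ℕ, ENNReal.ofReal (M.oneStepVar (state (k + 1) y))) y

omit [Countable X] [DecidableEq X] in
theorem measurableSet_exit : MeasurableSet {y : Path X | state 1 y ∉ G} :=
  measurable_state 1 (G.measurableSet.compl)

omit [DecidableEq X] in
theorem measurable_tsum_ofReal_oneStepVar :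
    Measurable (fun y : Path X => ∑' k : ℕ, ENNReal.ofReal (M.oneStepVar (state (k + 1) y))) := by
  have hm : Measurable M.oneStepVar := measurable_of_countable _
  exact Measurable.tsum fun k => (hm.comp (measurable_state _)).ennreal_ofReal

omit [DecidableEq X] in
theorem measurable_visitVar : Measurable (M.visitVar G) := by
  have hm : Measurable M.oneStepVar := measurable_of_countable _
  exact ((hm.comp (measurable_state 0)).ennreal_ofReal).add
    (measurable_tsum_ofReal_oneStepVar.indicator measurableSet_exit)

omit [Countable X] [MeasurableSingletonClass X] in
-- The variance at time `u` is charged to the visits that cause it: a visit at `u` itself, or an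
-- earlier visit followed by an exit. Regrouping by visits is an exchange of sums, which is
-- unconditional in `ℝ≥0∞`.
theorem tsum_ofReal_coef_mul (s : X) (x : Path X) :
    ∑' u, ENNReal.ofReal (coef G s u x * M.oneStepVar (state u x)) =
      ∑' t, if state t x = s then M.visitVar G (shift t x) else 0 := by
  set a : ℕ → ℝ≥0∞ := fun u => ENNReal.ofReal (M.oneStepVar (state u x)) with ha
  set e : ℕ → ℝ≥0∞ := fun t => if state t x = s ∧ state (t + 1) x ∉ G then 1 else 0 with he
  have h1 : ∀ u, ENNReal.ofReal (coef G s u x * M.oneStepVar (state u x)) =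
      (if state u x = s then a u else 0) + ∑' t, if t < u then e t * a u else 0 := by
    intro u
    have h2 : ENNReal.ofReal (coef G s u x) =
        (if state u x = s then 1 else 0) + ∑ t ∈ Finset.range u, e t := by
      rw [coef, ENNReal.ofReal_add (by split_ifs <;> simp)
        (Finset.sum_nonneg fun t _ => by split_ifs <;> simp),
        ENNReal.ofReal_sum_of_nonneg (fun t _ => by split_ifs <;> simp)]
      congr 1
      · split_ifs <;> simp
      · refine Finset.sum_congr rfl fun t _ => ?_
        simp only [he]
        split_ifs <;> simp
    have h3 : ∑' t, (if t < u then e t * a u else 0) = ∑ t ∈ Finset.range u, e t * a u := by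
      rw [tsum_eq_sum_range_of_terminal (n := u) (fun t ht => if_neg (by omega))]
      exact Finset.sum_congr rfl fun t ht => if_pos (Finset.mem_range.1 ht)
    rw [ENNReal.ofReal_mul (coef_nonneg s u x), h2, h3, add_mul, Finset.sum_mul]
    congr 1
    split_ifs <;> simp [ha]
  simp_rw [h1]
  rw [ENNReal.tsum_add, ENNReal.tsum_comm (f := fun u t => if t < u then e t * a u else 0)]
  have h4 : ∀ t, ∑' u, (if t < u then e t * a u else 0) = e t * ∑' k, a (t + 1 + k) := by
    intro t
    rw [tsum_ite_lt t (fun u => e t * a u), ENNReal.tsum_mul_left]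
  simp_rw [h4]
  rw [← ENNReal.tsum_add]
  refine tsum_congr fun t => ?_
  by_cases hs : state t x = s
  · simp only [hs, if_true, visitVar, state_shift, add_zero, he, true_and, ha, Set.indicator,
      Set.mem_ofPred_eq]
    congr 1
    by_cases hx : state (t + 1) x ∈ G
    · simp [hx]
    · simp only [hx, not_false_eq_true, if_true, one_mul]
      refine tsum_congr fun k => ?_
      rw [show t + 1 + k = t + (k + 1) by ring]
  · simp [hs, he]

/-- Since the weight is almost surely idempotent, its square may be replaced by the weight. The
limit of partial sums then becomes a series in `ℝ≥0∞`, regrouped by visits and evaluated by the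
Markov property. -/
theorem ofReal_integral_score_sq (hEff : M.EffectiveHorizon h) (hRew : M.BoundedReward)
    (hterm : M.terminal ∉ G) (hG : M.IsTransient G) {s : X} (hs : s ∈ G) :
    ENNReal.ofReal (∫ x, M.score G s x * M.score G s x ∂(M.pathLaw M.init)) =
      M.occupancy s * ∫⁻ y, M.visitVar G y ∂(M.lawFrom s) := by
  have hm : Measurable M.oneStepVar := measurable_of_countable _
  have h1 := (ENNReal.continuous_ofReal.tendsto _).comp
    (tendsto_sum_integral_coef hEff hRew hterm hG M.init hs hs)
  have hmeas : ∀ u, Measurable (fun x => coef G s u x * M.oneStepVar (state u x)) := by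
    intro u
    fun_prop
  have h2 : ∀ n, (ENNReal.ofReal ∘ fun n => ∑ u ∈ Finset.range n,
      ∫ x, coef G s u x * coef G s u x * M.oneStepVar (state u x) ∂(M.pathLaw M.init)) n =
      ∑ u ∈ Finset.range n,
        ∫⁻ x, ENNReal.ofReal (coef G s u x * M.oneStepVar (state u x)) ∂(M.pathLaw M.init) := by
    intro n
    have hnn : ∀ u, ∀ x, 0 ≤ coef G s u x * coef G s u x * M.oneStepVar (state u x) := fun u x =>
      mul_nonneg (mul_nonneg (coef_nonneg _ _ _) (coef_nonneg _ _ _)) (oneStepVar_nonneg _)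
    rw [Function.comp_apply, ENNReal.ofReal_sum_of_nonneg fun u _ => integral_nonneg (hnn u)]
    refine Finset.sum_congr rfl fun u _ => ?_
    have hae : ∀ᵐ x ∂(M.pathLaw M.init), coef G s u x * coef G s u x * M.oneStepVar (state u x) =
        coef G s u x * M.oneStepVar (state u x) := by
      filter_upwards [ae_leavesOnce hG M.init] with x hx
      rw [hx.coef_mul_coef hs hs, if_pos rfl]
    rw [integral_congr_ae hae, ofReal_integral_eq_lintegral_ofReal]
    · refine Integrable.of_bound (hmeas u).aestronglyMeasurable
        ((1 + u) * (2 * max h 0 + 1) ^ 2) (Eventually.of_forall fun x => ?_)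
      rw [Real.norm_eq_abs, abs_mul, abs_of_nonneg (coef_nonneg _ _ _),
        abs_of_nonneg (oneStepVar_nonneg _)]
      exact mul_le_mul (coef_le s u x) (oneStepVar_le hEff hRew _) (oneStepVar_nonneg _)
        (by positivity)
    · exact Eventually.of_forall fun x => mul_nonneg (coef_nonneg _ _ _) (oneStepVar_nonneg _)
  have h3 := (ENNReal.summable (f := fun u => ∫⁻ x, ENNReal.ofReal
    (coef G s u x * M.oneStepVar (state u x)) ∂(M.pathLaw M.init))).hasSum.tendsto_sum_nat
  have h4 := tendsto_nhds_unique (h1.congr h2) h3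
  rw [h4, ← lintegral_tsum fun u => ((hmeas u).ennreal_ofReal).aemeasurable]
  simp_rw [tsum_ofReal_coef_mul]
  exact M.lintegral_tsum_visits M.init s measurable_visitVar

omit [DecidableEq X] in
theorem Tame.summable_oneStepVar (hEff : M.EffectiveHorizon h) (hRew : M.BoundedReward)
    {x : Path X} (hx : M.Tame x) :
    Summable (fun k : ℕ => M.oneStepVar (state (k + 1) x)) := by
  obtain ⟨T, hT⟩ := hx.exists_terminal
  refine summable_of_ne_finset_zero (s := Finset.range T) fun k hk => ?_
  rw [state, hT _ (by simp at hk; omega), oneStepVar_terminal hEff hRew]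

omit [DecidableEq X] in
theorem Tame.tsum_oneStepVar_le (hEff : M.EffectiveHorizon h) (hRew : M.BoundedReward)
    {x : Path X} (hx : M.Tame x) :
    ∑' k : ℕ, M.oneStepVar (state (k + 1) x) ≤ (2 * max h 0 + 1) ^ 2 * (M.life x).toReal := by
  refine (hx.summable_oneStepVar hEff hRew).tsum_le_of_sum_le fun I => ?_
  refine (Finset.sum_le_sum fun k _ => oneStepVar_state_le hEff hRew (k + 1) x).trans ?_
  rw [← Finset.mul_sum]
  refine mul_le_mul_of_nonneg_left ?_ (by positivity)
  simpa using hx.sum_alive_le (I.map (addRightEmbedding 1))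

omit [DecidableEq X] in
theorem integrable_tsum_oneStepVar (hEff : M.EffectiveHorizon h) (hRew : M.BoundedReward)
    (ρ : Measure X) [IsProbabilityMeasure ρ] :
    Integrable (fun x => ∑' k : ℕ, M.oneStepVar (state (k + 1) x)) (M.pathLaw ρ) := by
  have hm : Measurable M.oneStepVar := measurable_of_countable _
  refine ((integrable_life hEff hRew ρ).const_mul ((2 * max h 0 + 1) ^ 2)).mono'
    (Measurable.tsum fun k => hm.comp (measurable_state (k + 1))).aestronglyMeasurable ?_
  filter_upwards [ae_tame hEff hRew ρ] with x hx
  rw [Real.norm_eq_abs, abs_of_nonneg (tsum_nonneg fun k => oneStepVar_nonneg _)]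
  exact hx.tsum_oneStepVar_le hEff hRew

omit [DecidableEq X] in
theorem integrable_cond_tsum_oneStepVar (hEff : M.EffectiveHorizon h) (hRew : M.BoundedReward)
    (s : X) : Integrable (fun x => ∑' t : ℕ, M.oneStepVar (state (t + 1) x))
      (cond (M.lawFrom s) {x | state 1 x ∉ G}) := by
  by_cases h0 : M.lawFrom s {x | state 1 x ∉ G} = 0
  · rw [cond_eq_zero_of_meas_eq_zero h0]
    exact integrable_zero_measure
  · have := integrable_tsum_oneStepVar hEff hRew (Measure.dirac s)
    exact (this.restrict (s := {x | state 1 x ∉ G})).smul_measure (ENNReal.inv_ne_top.2 h0)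

omit [Countable X] [DecidableEq X] [MeasurableSingletonClass X] in
-- Multiplying by the exit probability undoes the normalization of the conditional law. If the exit
-- has probability zero, both sides are zero by convention.
theorem exitProb_mul_sigmaOut (s : X) :
    M.exitProb G s * M.sigmaOut G s =
      ∫ x in {x | state 1 x ∉ G}, ∑' t : ℕ, M.oneStepVar (state (t + 1) x) ∂(M.lawFrom s) := by
  rw [exitProb, sigmaOut]
  by_cases h0 : M.lawFrom s {x | state 1 x ∉ G} = 0
  · rw [Measure.restrict_eq_zero.2 h0, Measure.real, h0]
    simp
  · rw [ProbabilityTheory.cond, integral_smul_measure, smul_eq_mul, ← mul_assoc, Measure.real, ENNReal.toReal_inv,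
      mul_inv_cancel₀ (ENNReal.toReal_ne_zero.2 ⟨h0, measure_ne_top _ _⟩), one_mul]

omit [DecidableEq X] in
theorem lintegral_visitVar (hEff : M.EffectiveHorizon h) (hRew : M.BoundedReward) (s : X) :
    ∫⁻ y, M.visitVar G y ∂(M.lawFrom s) =
      ENNReal.ofReal (M.oneStepVar s + M.exitProb G s * M.sigmaOut G s) := by
  have hm : Measurable M.oneStepVar := measurable_of_countable _
  have h1 : ∫⁻ y, ENNReal.ofReal (M.oneStepVar (state 0 y)) ∂(M.lawFrom s) =
      ENNReal.ofReal (M.oneStepVar s) := by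
    have : ∀ᵐ y ∂(M.lawFrom s), ENNReal.ofReal (M.oneStepVar (state 0 y)) =
        ENNReal.ofReal (M.oneStepVar s) := by
      filter_upwards [M.ae_state_zero s] with y hy
      rw [hy]
    rw [lintegral_congr_ae this]
    simp
  have hi : Integrable (fun x => ∑' t : ℕ, M.oneStepVar (state (t + 1) x)) (M.lawFrom s) :=
    integrable_tsum_oneStepVar hEff hRew (Measure.dirac s)
  have hnn : ∀ x : Path X, 0 ≤ ∑' t : ℕ, M.oneStepVar (state (t + 1) x) := fun x =>
    tsum_nonneg fun k => oneStepVar_nonneg _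
  rw [exitProb_mul_sigmaOut, ENNReal.ofReal_add (oneStepVar_nonneg s)
    (integral_nonneg hnn),
    ofReal_integral_eq_lintegral_ofReal (hi.restrict (s := {x | state 1 x ∉ G}))
      (Eventually.of_forall hnn)]
  unfold visitVar
  rw [lintegral_add_left ((hm.fun_comp (measurable_state 0)).ennreal_ofReal), h1,
    lintegral_indicator measurableSet_exit]
  congr 1
  refine lintegral_congr_ae (ae_restrict_of_ae ?_)
  filter_upwards [ae_tame hEff hRew (Measure.dirac s)] with x hx
  rw [ENNReal.ofReal_tsum_of_nonneg (fun k => oneStepVar_nonneg _)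
    (hx.summable_oneStepVar hEff hRew)]

omit [Countable X] [DecidableEq X] [MeasurableSingletonClass X] in
theorem visitVar_nonneg (s : X) : 0 ≤ M.oneStepVar s + M.exitProb G s * M.sigmaOut G s := by
  rw [exitProb_mul_sigmaOut]
  exact add_nonneg (oneStepVar_nonneg s)
    (integral_nonneg fun x => tsum_nonneg fun k => oneStepVar_nonneg _)

omit [Countable X] [DecidableEq X] [MeasurableSingletonClass X] in
theorem effVar_nonneg (s : X) : 0 ≤ M.effVar G s :=
  div_nonneg (visitVar_nonneg s) ENNReal.toReal_nonneg

theorem integral_score_sq (hEff : M.EffectiveHorizon h) (hRew : M.BoundedReward)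
    (hterm : M.terminal ∉ G) (hG : M.IsTransient G) {s : X} (hs : s ∈ G) :
    ∫ x, M.score G s x * M.score G s x ∂(M.pathLaw M.init) =
      (M.occupancy s).toReal * (M.oneStepVar s + M.exitProb G s * M.sigmaOut G s) := by
  have h1 := congrArg ENNReal.toReal (ofReal_integral_score_sq hEff hRew hterm hG hs)
  rwa [ENNReal.toReal_ofReal (integral_nonneg fun x => mul_self_nonneg _), ENNReal.toReal_mul,
    lintegral_visitVar hEff hRew, ENNReal.toReal_ofReal (visitVar_nonneg s)] at h1

theorem lambdaStar_eq_diagonal (hEff : M.EffectiveHorizon h) (hRew : M.BoundedReward)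
    (hterm : M.terminal ∉ G) (hG : M.IsTransient G) :
    M.lambdaStar G = Matrix.diagonal fun s : G =>
      (M.occupancy s).toReal * (M.oneStepVar s + M.exitProb G s * M.sigmaOut G s) := by
  ext s s'
  rw [lambdaStar, Matrix.of_apply, covariance, integral_score hEff hRew hterm hG M.init s.2,
    integral_score hEff hRew hterm hG M.init s'.2]
  simp only [sub_zero]
  by_cases hss : s = s'
  · subst hss
    rw [Matrix.diagonal_apply_eq, integral_score_sq hEff hRew hterm hG s.2]
  · rw [Matrix.diagonal_apply_ne _ hss]
    exact integral_score_mul_of_ne hEff hRew hterm hG M.init s.2 s'.2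
      (fun he => hss (Subtype.ext he))

theorem sigmaStar_eq_diagonal (hEff : M.EffectiveHorizon h) (hRew : M.BoundedReward)
    (hterm : M.terminal ∉ G) (hν : ∀ s ∈ G, 0 < M.occupancy s) (hG : M.IsTransient G) :
    M.sigmaStar G = Matrix.diagonal fun s : G => M.effVar G s := by
  rw [sigmaStar, lambdaStar_eq_diagonal hEff hRew hterm hG, Matrix.diagonal_mul_diagonal,
    Matrix.diagonal_mul_diagonal]
  congr 1
  ext s
  have h1 : (M.occupancy s).toReal ≠ 0 := ENNReal.toReal_ne_zero.2
    ⟨(hν s s.2).ne', (occupancy_lt_top hEff hRew (fun he => hterm (he ▸ s.2))).ne⟩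
  rw [effVar]
  field_simp

theorem wellDefined (hEff : M.EffectiveHorizon h) (hRew : M.BoundedReward)
    (hterm : M.terminal ∉ G) (hG : M.IsTransient G) : M.WellDefined G where
  terminates s := by
    filter_upwards [ae_tame hEff hRew (Measure.dirac s)] with x hx using hx.exists_terminal
  terminates_init := by
    filter_upwards [ae_tame hEff hRew M.init] with x hx using hx.exists_terminal
  integrable_return s := integrable_rewardToGo hEff hRew (Measure.dirac s) 0
  memLp_oneStep s := memLp_rew_add_value hEff hRew s
  integrable_sigmaOut s := integrable_cond_tsum_oneStepVar hEff hRew s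
  occupancy_lt_top s hs := occupancy_lt_top hEff hRew (fun he => hterm (he ▸ hs))
  expectedVisits_lt_top s _ s' hs' := expectedVisits_lt_top hEff hRew s (fun he => hterm (he ▸ hs'))
  memLp_score s hs := memLp_score hEff hRew hterm hG M.init hs

variable (M G) in
/-- The matrix `E[N(s') | S₀ = s]` of expected numbers of visits within `G`. -/
noncomputable def visitsMatrix : Matrix G G ℝ :=
  Matrix.of fun s s' => (M.expectedVisits s s').toReal

/-- First-step analysis. In general the sum would run over all successors; transience removes those
outside `G`. -/
theorem expectedVisits_eq (hG : M.IsTransient G) {s s' : X} (hs : s ∈ G) (hs' : s' ∈ G) :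
    M.expectedVisits s s' = (if s = s' then 1 else 0) +
      ∑ y ∈ G, M.trans s {y} * M.expectedVisits y s' := by
  have hmv : Measurable (visits s' : Path X → ℝ≥0∞) := Measurable.tsum fun t =>
    Measurable.ite (measurable_state t (measurableSet_singleton s')) measurable_const
      measurable_const
  have h1 : ∀ᵐ x ∂(M.lawFrom s), visits s' x = (if s = s' then 1 else 0) +
      ∑ y ∈ G, {x | state 1 x = y}.indicator 1 x * visits s' (shift 1 x) := by
    filter_upwards [M.ae_state_zero s, ae_leavesOnce hG (Measure.dirac s)] with x h0 hx
    have h2 : visits s' x = (if state 0 x = s' then 1 else 0) + visits s' (shift 1 x) := by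
      rw [visits, tsum_eq_zero_add' ENNReal.summable, visits]
      congr 1
      refine tsum_congr fun t => ?_
      rw [state_shift, add_comm]
    rw [h2, h0]
    congr 1
    by_cases h3 : state 1 x ∈ G
    · rw [Finset.sum_eq_single_of_mem _ h3]
      · simp
      · intro y _ hne
        rw [Set.indicator_of_notMem (by exact fun he => hne he.symm), zero_mul]
    -- Having left `G` at the first step, the path never visits `s' ∈ G` again.
    · have h4 : visits s' (shift 1 x) = 0 := by
        refine ENNReal.tsum_eq_zero.2 fun t => if_neg fun he => ?_
        exact hx 0 (h0 ▸ hs) h3 (1 + t) (by omega) (by rw [← state_shift, he]; exact hs')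
      simp [h4]
  have hms : ∀ y, MeasurableSet {x : Path X | state 1 x = y} := fun y =>
    measurable_state 1 (measurableSet_singleton y)
  rw [expectedVisits, lintegral_congr_ae h1, lintegral_add_left measurable_const,
    lintegral_finsetSum _ fun y _ => (measurable_one.indicator (hms y)).fun_mul
      (hmv.fun_comp (measurable_shift 1))]
  simp only [lintegral_const, measure_univ, mul_one]
  congr 1
  refine Finset.sum_congr rfl fun y _ => ?_
  have h5 := M.lintegral_past_mul (Measure.dirac s) (u := 1)
    (w := {x | state 1 x = y}.indicator 1) (g := visits s')
    (measurable_one.indicator (hms y)) hmv (fun x z hz => by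
      simp only [Set.indicator, Set.mem_ofPred_eq, state_splice le_rfl hz, Pi.one_apply])
  have h6 : ∀ x : Path X, ({x | state 1 x = y}.indicator 1 x : ℝ≥0∞) *
      ∫⁻ z, visits s' z ∂(M.lawFrom (state 1 x)) =
      {x | state 1 x = y}.indicator 1 x * M.expectedVisits y s' := by
    intro x
    by_cases hx : state 1 x = y <;> simp [hx, expectedVisits]
  refine h5.trans ?_
  simp_rw [h6]
  rw [lintegral_mul_const _ (measurable_one.indicator (hms y)), lintegral_indicator_one (hms y),
    ← M.map_state_one s, Measure.map_apply (measurable_state 1) (measurableSet_singleton y)]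
  rfl

/-- The first-step equations in matrix form; finiteness of the expected visits allows passing from
`ℝ≥0∞` to `ℝ`. For square matrices a right inverse suffices. -/
theorem one_sub_transOn_mul_visitsMatrix (hEff : M.EffectiveHorizon h) (hRew : M.BoundedReward)
    (hterm : M.terminal ∉ G) (hG : M.IsTransient G) :
    (1 - M.transOn G) * M.visitsMatrix G = 1 := by
  have hne : ∀ s ∈ G, s ≠ M.terminal := fun s hs he => hterm (he ▸ hs)
  rw [sub_mul, one_mul, sub_eq_iff_eq_add]
  ext s s'
  have hfin : ∀ y ∈ G, M.trans s {y} * M.expectedVisits y s' ≠ ∞ := fun y _ =>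
    ENNReal.mul_ne_top (measure_ne_top _ _) (expectedVisits_lt_top hEff hRew y (hne _ s'.2)).ne
  rw [visitsMatrix, Matrix.of_apply, expectedVisits_eq hG s.2 s'.2, ENNReal.toReal_add
    (by split_ifs <;> simp) (ENNReal.sum_ne_top.2 hfin), ENNReal.toReal_sum hfin,
    Matrix.add_apply, Matrix.mul_apply, Matrix.one_apply, ← Finset.sum_coe_sort G]
  congr 1
  · simp only [Subtype.ext_iff]
    split_ifs <;> simp
  · refine Finset.sum_congr rfl fun y _ => ?_
    rw [ENNReal.toReal_mul]
    rfl

theorem isUnit_one_sub_transOn (hEff : M.EffectiveHorizon h) (hRew : M.BoundedReward)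
    (hterm : M.terminal ∉ G) (hG : M.IsTransient G) : IsUnit (1 - M.transOn G) :=
  IsUnit.of_mul_eq_one _ (one_sub_transOn_mul_visitsMatrix hEff hRew hterm hG)

theorem inv_one_sub_transOn (hEff : M.EffectiveHorizon h) (hRew : M.BoundedReward)
    (hterm : M.terminal ∉ G) (hG : M.IsTransient G) :
    (1 - M.transOn G)⁻¹ = M.visitsMatrix G :=
  Matrix.inv_eq_right_inv (one_sub_transOn_mul_visitsMatrix hEff hRew hterm hG)

end Occupation

end MRP

namespace MRP

/-! ### Deterministic analysis of the empirical equation. -/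

section Estimator

variable {X : Type*} [DecidableEq X]

/-- The sum of `f` over all sub-trajectories of `x` that start at `s`. -/
noncomputable def visitSum (f : Path X → ℝ) (s : X) (x : Path X) : ℝ :=
  ∑' t, if state t x = s then f (shift t x) else 0

theorem empMean_eq {n : ℕ} (D : Fin n → Path X) (f : Path X → ℝ) (s : X) :
    empMean D f s = (∑ i, visitSum f s (D i)) / ∑ i, visitSum (fun _ => 1) s (D i) := rfl

theorem visitSum_eq_sum {f : Path X → ℝ} {s e : X} (hs : s ≠ e) {x : Path X} {T : ℕ}
    (hT : ∀ t ≥ T, x t = (e, 0)) :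
    visitSum f s x = ∑ t ∈ Finset.range T, if state t x = s then f (shift t x) else 0 :=
  tsum_eq_sum_range_of_terminal fun t ht => if_neg fun h => hs (by
    rw [← h, state, hT t ht])

omit [DecidableEq X] in
theorem exists_common_terminal {n : ℕ} {D : Fin n → Path X} {e : X}
    (hD : ∀ i, ∃ T, ∀ t ≥ T, D i t = (e, 0)) : ∃ T, ∀ i, ∀ t ≥ T, D i t = (e, 0) := by
  choose T hT using hD
  exact ⟨Finset.univ.sup T, fun i t ht => hT i t ((Finset.le_sup (Finset.mem_univ i)).trans ht)⟩

variable {n : ℕ} {G : Finset X} {D : Fin n → Path X} {e : X}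

variable (G D) in
/-- The empirical transition matrix on `G`. -/
noncomputable def empTransMatrix : Matrix G G ℝ := Matrix.of fun s s' => empTrans D s s'

/-- Maximum principle: a fixed point of the empirical transition matrix is nonpositive, because
its maximum would propagate along the data until termination. -/
theorem nonpos_of_empTrans_fixed (he : e ∉ G) (hD : ∀ i, ∃ T, ∀ t ≥ T, D i t = (e, 0))
    {v : G → ℝ} (hv : ∀ s : G, v s = ∑ s' : G, empTrans D s s' * v s') (s : G) : v s ≤ 0 := by
  obtain ⟨T, hT⟩ := exists_common_terminal hD
  obtain ⟨a, -, ha⟩ := Finset.exists_max_image Finset.univ v ⟨s, Finset.mem_univ s⟩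
  by_contra! hs
  have ha0 : 0 < v a := hs.trans_le (ha s (Finset.mem_univ s))
  -- `w` extends `v` by zero, so that `v b` is the average of `w` over the observed successors of
  -- `b`; it vanishes at the endpoint `e`.
  let w : X → ℝ := fun y => if hy : y ∈ G then v ⟨y, hy⟩ else 0
  have hwe : w e = 0 := dif_neg he
  have hw : ∀ y, w y ≤ v a := by
    intro y
    by_cases hy : y ∈ G
    · simp only [w, hy, dif_pos]; exact ha _ (Finset.mem_univ _)
    · simp only [w, hy, dif_neg, not_false_eq_true]; exact ha0.le
  have hG : ∀ b : G, (b : X) ≠ e := fun b hb => he (hb ▸ b.2)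
  have hwsum : ∀ y : X, ∑ s' : G, (if y = s' then (1 : ℝ) else 0) * v s' = w y := by
    intro y
    by_cases hy : y ∈ G
    · rw [Finset.sum_eq_single_of_mem ⟨y, hy⟩ (Finset.mem_univ _)]
      · simp [w, hy]
      · intro b _ hb
        rw [if_neg (fun h => hb (Subtype.ext h.symm)), zero_mul]
    · simp only [w, hy, dif_neg, not_false_eq_true]
      refine Finset.sum_eq_zero fun b _ => ?_
      have hyb : y ≠ b := fun h => hy (h ▸ b.2)
      rw [if_neg hyb, zero_mul]
  -- By the convention `0 / 0 = 0`, an unvisited state has a zero row and hence value zero.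
  have hN : ∀ b : G, 0 < v b → (∑ i, visitSum (fun _ => 1) (b : X) (D i)) ≠ 0 := by
    intro b hb h0
    have := hv b
    simp only [empTrans, empMean_eq, h0, div_zero, zero_mul, Finset.sum_const_zero] at this
    exact hb.ne' this
  -- If an average of numbers that are at most `v a` equals `v a`, each of them equals `v a`.
  have hbal : ∀ b : G, v b = v a → ∀ i t, state t (D i) = b →
      w (state (t + 1) (D i)) = v a := by
    intro b hb i t hst
    have h1 := hv b
    have hNb := hN b (hb ▸ ha0)
    simp only [empTrans, empMean_eq] at h1
    have h2 : v b * (∑ i, visitSum (fun _ => 1) (b : X) (D i)) =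
        ∑ i, ∑ t ∈ Finset.range T, if state t (D i) = b then w (state (t + 1) (D i)) else 0 := by
      conv_lhs => rw [h1]
      rw [Finset.sum_mul]
      have h3 : ∀ s' : G, (∑ i, visitSum (fun x => if state 1 x = (s' : X) then 1 else 0) (b : X) (D i)) /
          (∑ i, visitSum (fun _ => 1) (b : X) (D i)) * v s' *
          (∑ i, visitSum (fun _ => 1) (b : X) (D i)) =
          ∑ i, ∑ t ∈ Finset.range T, (if state t (D i) = b then
            (if state (t + 1) (D i) = s' then (1 : ℝ) else 0) * v s' else 0) := by
        intro s'
        rw [mul_right_comm, div_mul_cancel₀ _ hNb, Finset.sum_mul]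
        refine Finset.sum_congr rfl fun i _ => ?_
        rw [visitSum_eq_sum (hG b) (hT i), Finset.sum_mul]
        refine Finset.sum_congr rfl fun t _ => ?_
        rw [ite_mul, zero_mul, state_shift]
      simp_rw [h3]
      rw [Finset.sum_comm]
      refine Finset.sum_congr rfl fun i _ => ?_
      rw [Finset.sum_comm]
      refine Finset.sum_congr rfl fun t _ => ?_
      split_ifs
      · exact hwsum _
      · simp
    have h4 : ∑ i, ∑ t ∈ Finset.range T,
        (if state t (D i) = b then v a - w (state (t + 1) (D i)) else 0) = 0 := by
      have h5 : ∑ i, visitSum (fun _ => 1) (b : X) (D i) =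
          ∑ i, ∑ t ∈ Finset.range T, if state t (D i) = b then (1 : ℝ) else 0 :=
        Finset.sum_congr rfl fun i _ => visitSum_eq_sum (hG b) (hT i)
      rw [h5, hb, Finset.mul_sum] at h2
      refine Eq.trans ?_ (sub_eq_zero.2 h2)
      rw [← Finset.sum_sub_distrib]
      refine Finset.sum_congr rfl fun i _ => ?_
      rw [Finset.mul_sum, ← Finset.sum_sub_distrib]
      refine Finset.sum_congr rfl fun t _ => ?_
      split_ifs <;> simp
    have hnn : ∀ j t, 0 ≤ (if state t (D j) = b then v a - w (state (t + 1) (D j)) else 0) := by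
      intro j t
      split_ifs
      · linarith [hw (state (t + 1) (D j))]
      · exact le_rfl
    have ht : t ∈ Finset.range T := by
      by_contra hlt
      exact hG b (by rw [← hst, state, hT i t (by simpa using hlt)])
    have h6 := (Finset.sum_eq_zero_iff_of_nonneg fun j _ => Finset.sum_nonneg fun t _ => hnn j t).1
      h4 i (Finset.mem_univ i)
    have h7 := (Finset.sum_eq_zero_iff_of_nonneg fun t _ => hnn i t).1 h6 t ht
    rw [if_pos hst] at h7
    linarith
  obtain ⟨i, t, hit⟩ : ∃ i t, state t (D i) = a := by
    by_contra! hno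
    refine hN a ha0 (Finset.sum_eq_zero fun i _ => ?_)
    simp [visitSum, hno i]
  -- The positive maximum keeps the path in `G` forever, which contradicts termination at `e`.
  have hprop : ∀ k, w (state (t + k) (D i)) = v a := by
    intro k
    induction k with
    | zero => rw [add_zero, hit]; simp [w]
    | succ k ih =>
      have hmem : state (t + k) (D i) ∈ G := by
        by_contra hn
        rw [show w (state (t + k) (D i)) = 0 from dif_neg hn] at ih
        exact ha0.ne ih
      refine hbal ⟨_, hmem⟩ ?_ i (t + k) rfl
      rw [← ih]
      simp [w, hmem]
  have := hprop T
  rw [state, hT i (t + T) (by omega), hwe] at this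
  exact ha0.ne this

theorem isUnit_one_sub_empTransMatrix (he : e ∉ G) (hD : ∀ i, ∃ T, ∀ t ≥ T, D i t = (e, 0)) :
    IsUnit (1 - empTransMatrix G D) := by
  rw [← Matrix.mulVec_injective_iff_isUnit]
  refine (injective_iff_map_eq_zero (1 - empTransMatrix G D).mulVecLin).2 ?_
  intro v hv
  have hv' : ∀ s : G, v s = ∑ s' : G, empTrans D s s' * v s' := by
    intro s
    have := congrFun hv s
    simp only [Matrix.mulVecLin_apply, Matrix.sub_mulVec, Matrix.one_mulVec, Pi.sub_apply,
      Pi.zero_apply] at this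
    exact sub_eq_zero.1 this
  -- The kernel is a linear space, so the maximum principle applied to `v` and `-v` forces `v = 0`.
  have hneg : ∀ s : G, (-v) s = ∑ s' : G, empTrans D s s' * (-v) s' := by
    intro s
    simp only [Pi.neg_apply, mul_neg, Finset.sum_neg_distrib]
    rw [← hv' s]
  funext s
  have h1 := nonpos_of_empTrans_fixed he hD hv' s
  have h2 := nonpos_of_empTrans_fixed he hD hneg s
  simp only [Pi.neg_apply] at h2
  simp only [Pi.zero_apply]
  linarith

theorem isSubgraphBellman_iff {v : G → ℝ} :
    IsSubgraphBellman G D v ↔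
      (1 - empTransMatrix G D) *ᵥ v = fun s : G => empReward D s + empOut G D s := by
  rw [IsSubgraphBellman, funext_iff]
  refine forall_congr' fun s => ?_
  rw [Matrix.sub_mulVec, Matrix.one_mulVec, Pi.sub_apply, sub_eq_iff_eq_add]
  have : (empTransMatrix G D *ᵥ v) s = ∑ s' : G, empTrans D s s' * v s' := rfl
  rw [this]
  constructor <;> intro h <;> rw [h] <;> ring

theorem isSubgraphBellman_iff_eq (he : e ∉ G) (hD : ∀ i, ∃ T, ∀ t ≥ T, D i t = (e, 0))
    {v : G → ℝ} : IsSubgraphBellman G D v ↔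
      v = (1 - empTransMatrix G D)⁻¹ *ᵥ fun s : G => empReward D s + empOut G D s := by
  have hu := isUnit_one_sub_empTransMatrix he hD
  rw [isSubgraphBellman_iff]
  constructor
  · intro h
    rw [← h, Matrix.mulVec_mulVec, Matrix.nonsing_inv_mul _
      ((Matrix.isUnit_iff_isUnit_det _).1 hu), Matrix.one_mulVec]
  · intro h
    rw [h, Matrix.mulVec_mulVec, Matrix.mul_nonsing_inv _
      ((Matrix.isUnit_iff_isUnit_det _).1 hu), Matrix.one_mulVec]

theorem existsUnique_isSubgraphBellman (he : e ∉ G)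
    (hD : ∀ i, ∃ T, ∀ t ≥ T, D i t = (e, 0)) : ∃! v : G → ℝ, IsSubgraphBellman G D v := by
  simp_rw [isSubgraphBellman_iff_eq he hD]
  exact existsUnique_eq

variable [MeasurableSpace X] {M : MRP X}

/-- The score is the centered regression target of the estimator, summed over the visits. -/
theorem score_eq_visitSum (hterm : M.terminal ∉ G) {s : X} (hs : s ∈ G) {x : Path X}
    (hx : ∃ T, ∀ t ≥ T, x t = (M.terminal, 0)) :
    M.score G s x = M.value s * visitSum (fun _ => 1) s x - visitSum (rew 0) s x -
      ∑ s' : G, visitSum (fun y => if state 1 y = (s' : X) then 1 else 0) s x * M.value s' -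
      visitSum (fun y => if state 1 y ∉ G then rewardToGo 1 y else 0) s x := by
  obtain ⟨T, hT⟩ := hx
  have hse : s ≠ M.terminal := fun h => hterm (h ▸ hs)
  have h0 : M.score G s x = ∑ t ∈ Finset.range T, (M.tdTerm s t x + M.mcTerm G s t x) := by
    refine tsum_eq_sum_range_of_terminal fun t ht => ?_
    have : state t x ≠ s := fun h => hse (by rw [← h, state, hT t ht])
    simp [tdTerm, mcTerm, this]
  simp only [visitSum_eq_sum hse hT, h0, Finset.sum_mul, Finset.mul_sum]
  rw [Finset.sum_comm (s := Finset.univ), ← Finset.sum_sub_distrib, ← Finset.sum_sub_distrib,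
    ← Finset.sum_sub_distrib]
  refine Finset.sum_congr rfl fun t _ => ?_
  rw [tdTerm, mcTerm]
  by_cases hst : state t x = s
  · simp only [hst, if_true, true_and, state_shift, rew_shift, rewardToGo_shift, add_zero, mul_one]
    -- Inside `G` the sum over `s'` selects the value of the successor. Outside, that value cancels
    -- between the two error terms and only observed rewards remain.
    by_cases hy : state (t + 1) x ∈ G
    · rw [Finset.sum_eq_single_of_mem ⟨_, hy⟩ (Finset.mem_univ _)]
      · simp [hy]
      · intro b _ hb
        have hyb : state (t + 1) x ≠ b := fun h => hb (Subtype.ext h.symm)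
        exact mul_eq_zero_of_left (if_neg hyb) _
    · have hyb : ∀ b : G, state (t + 1) x ≠ b := fun b h => hy (h ▸ b.2)
      rw [Finset.sum_eq_zero fun (b : G) _ => mul_eq_zero_of_left (if_neg (hyb b)) _]
      simp only [hy, not_false_eq_true, if_true]
      ring
  · simp [hst]

/-- Both `V⋆` and the estimate are inserted in the empirical equation: the estimate solves it, and
the residual of `V⋆` at each state is its total score over its number of visits. No probability is
involved; only visited states are needed. -/
theorem value_sub_estimate_eq (hterm : M.terminal ∉ G)
    (hD : ∀ i, ∃ T, ∀ t ≥ T, D i t = (M.terminal, 0))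
    (hN : ∀ s ∈ G, (∑ i, visitSum (fun _ => 1) s (D i)) ≠ 0) {v : G → ℝ}
    (hv : IsSubgraphBellman G D v) (s : G) :
    M.value s - v s = ∑ s' : G, (1 - empTransMatrix G D)⁻¹ s s' *
      ((∑ i, visitSum (fun _ => 1) (s' : X) (D i))⁻¹ * ∑ i, M.score G s' (D i)) := by
  have hu := isUnit_one_sub_empTransMatrix hterm hD
  have h1 : (1 - empTransMatrix G D) *ᵥ (fun s : G => M.value s - v s) = fun s' : G =>
      (∑ i, visitSum (fun _ => 1) (s' : X) (D i))⁻¹ * ∑ i, M.score G s' (D i) := by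
    have h2 : (fun s : G => M.value s - v s) = (fun s : G => M.value s) - v := rfl
    rw [h2, Matrix.mulVec_sub, isSubgraphBellman_iff.1 hv]
    funext b
    have hb := hN b b.2
    have h3 : ((1 - empTransMatrix G D) *ᵥ fun s : G => M.value s) b =
        M.value b - ∑ s' : G, empTrans D b s' * M.value s' := by
      rw [Matrix.sub_mulVec, Matrix.one_mulVec]
      rfl
    have h4 : ∑ i, M.score G b (D i) = M.value b * ∑ i, visitSum (fun _ => 1) (b : X) (D i) -
        ∑ i, visitSum (rew 0) (b : X) (D i) -
        ∑ s' : G, (∑ i, visitSum (fun y => if state 1 y = (s' : X) then 1 else 0) (b : X) (D i)) *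
          M.value s' -
        ∑ i, visitSum (fun y => if state 1 y ∉ G then rewardToGo 1 y else 0) (b : X) (D i) := by
      simp only [fun i => score_eq_visitSum hterm b.2 (hD i), Finset.sum_sub_distrib,
        Finset.mul_sum, Finset.sum_mul]
      rw [Finset.sum_comm (s := Finset.univ) (t := (Finset.univ : Finset G))]
    rw [Pi.sub_apply, h3, h4]
    simp only [empTrans, empReward, empOut, empMean_eq]
    have h5 : ∀ s' : G, (∑ i, visitSum (fun x => if state 1 x = (s' : X) then 1 else 0) (b : X) (D i)) /
        (∑ i, visitSum (fun _ => 1) (b : X) (D i)) * M.value s' =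
        (∑ i, visitSum (fun _ => 1) (b : X) (D i))⁻¹ *
        ((∑ i, visitSum (fun x => if state 1 x = (s' : X) then 1 else 0) (b : X) (D i)) *
          M.value s') := fun s' => by
      rw [div_eq_mul_inv]; ring
    simp_rw [h5]
    rw [← Finset.mul_sum, div_eq_inv_mul, div_eq_inv_mul]
    linear_combination (-M.value b) * inv_mul_cancel₀ hb
  have h6 : (fun s : G => M.value s - v s) = (1 - empTransMatrix G D)⁻¹ *ᵥ fun s' : G =>
      (∑ i, visitSum (fun _ => 1) (s' : X) (D i))⁻¹ * ∑ i, M.score G s' (D i) := by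
    rw [← h1, Matrix.mulVec_mulVec, Matrix.nonsing_inv_mul _
      ((Matrix.isUnit_iff_isUnit_det _).1 hu), Matrix.one_mulVec]
  exact congrFun h6 s

end Estimator

end MRP

namespace MRP

open scoped RealInnerProductSpace

/-! ### Gaussian vectors and the multivariate central limit theorem. -/

section Gaussian

variable {ι : Type*} [Fintype ι] [DecidableEq ι]

omit [DecidableEq ι] in
theorem inner_toLp_eq_dotProduct (x : ι → ℝ) (t : EuclideanSpace ℝ ι) :
    ⟪(WithLp.toLp 2 x : EuclideanSpace ℝ ι), t⟫ = ∑ i, t i * x i := by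
  simp [PiLp.inner_apply]

/-- The image of a Gaussian vector under a linear map is Gaussian. -/
theorem map_mulVec_multivariateGaussian {S : Matrix ι ι ℝ} (hS : S.PosSemidef)
    (B : Matrix ι ι ℝ) :
    (multivariateGaussian 0 S).map
        (fun z => (WithLp.toLp 2 (B *ᵥ WithLp.ofLp z) : EuclideanSpace ℝ ι)) =
      multivariateGaussian 0 (B * S * Bᵀ) := by
  have hBS : (B * S * Bᵀ).PosSemidef := by
    have := hS.mul_mul_conjTranspose_same B
    rwa [Matrix.conjTranspose_eq_transpose_of_trivial] at this
  have hc : Continuous (fun z : EuclideanSpace ℝ ι =>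
      (WithLp.toLp 2 (B *ᵥ WithLp.ofLp z) : EuclideanSpace ℝ ι)) := by fun_prop
  have : IsProbabilityMeasure ((multivariateGaussian 0 S).map
      (fun z => (WithLp.toLp 2 (B *ᵥ WithLp.ofLp z) : EuclideanSpace ℝ ι))) :=
    Measure.isProbabilityMeasure_map hc.aemeasurable
  refine Measure.ext_of_charFun ?_
  ext t
  have h1 : charFun ((multivariateGaussian 0 S).map
      (fun z => (WithLp.toLp 2 (B *ᵥ WithLp.ofLp z) : EuclideanSpace ℝ ι))) t =
      charFun (multivariateGaussian 0 S)
        (WithLp.toLp 2 (Bᵀ *ᵥ WithLp.ofLp t) : EuclideanSpace ℝ ι) := by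
    rw [charFun_apply, integral_map hc.aemeasurable (by fun_prop), charFun_apply]
    refine integral_congr_ae (Eventually.of_forall fun z => ?_)
    have h2 : ⟪(WithLp.toLp 2 (B *ᵥ WithLp.ofLp z) : EuclideanSpace ℝ ι), t⟫ =
        ⟪z, (WithLp.toLp 2 (Bᵀ *ᵥ WithLp.ofLp t) : EuclideanSpace ℝ ι)⟫ := by
      rw [real_inner_comm _ z, inner_toLp_eq_dotProduct, inner_toLp_eq_dotProduct]
      change WithLp.ofLp t ⬝ᵥ (B *ᵥ WithLp.ofLp z) = WithLp.ofLp z ⬝ᵥ (Bᵀ *ᵥ WithLp.ofLp t)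
      rw [Matrix.dotProduct_mulVec, Matrix.mulVec_transpose, dotProduct_comm]
    simp only [h2]
  rw [h1, charFun_multivariateGaussian hS, charFun_multivariateGaussian hBS]
  congr 2
  · simp
  · congr 2
    change (Bᵀ *ᵥ WithLp.ofLp t) ⬝ᵥ S *ᵥ (Bᵀ *ᵥ WithLp.ofLp t) =
      WithLp.ofLp t ⬝ᵥ (B * S * Bᵀ) *ᵥ WithLp.ofLp t
    rw [← Matrix.mulVec_mulVec, ← Matrix.mulVec_mulVec, Matrix.dotProduct_mulVec _ B,
      Matrix.mulVec_transpose]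

variable {Ω : Type*} [MeasurableSpace Ω] {P : Measure Ω} [IsProbabilityMeasure P]

/-- **Multivariate central limit theorem** for centered random vectors. -/
theorem tendstoInDistribution_multivariateGaussian {W : ℕ → Ω → ι → ℝ}
    (hindep : iIndepFun W P) (hident : ∀ k, IdentDistrib (W k) (W 0) P P)
    (hL2 : ∀ i, MemLp (fun ω => W 0 ω i) 2 P) (h0 : ∀ i, ∫ ω, W 0 ω i ∂P = 0)
    {S : Matrix ι ι ℝ} (hS : S.PosSemidef) (hcov : ∀ i j, ∫ ω, W 0 ω i * W 0 ω j ∂P = S i j) :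
    TendstoInDistribution
      (fun (n : ℕ) ω => (WithLp.toLp 2 fun i => (√(n : ℝ))⁻¹ * ∑ k ∈ Finset.range n, W k ω i :
        EuclideanSpace ℝ ι)) atTop id (fun _ => P) (multivariateGaussian 0 S) := by
  have hmeas : ∀ k i, AEMeasurable (fun ω => W k ω i) P := fun k i =>
    (measurable_pi_apply i).comp_aemeasurable (hident k).aemeasurable_fst
  have hZ : ∀ n : ℕ, AEMeasurable (fun ω => (WithLp.toLp 2 fun i =>
      (√(n : ℝ))⁻¹ * ∑ k ∈ Finset.range n, W k ω i : EuclideanSpace ℝ ι)) P := by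
    intro n
    refine (WithLp.measurable_toLp 2 _).comp_aemeasurable (aemeasurable_pi_lambda _ fun i => ?_)
    exact (Finset.aemeasurable_fun_sum _ fun k _ => hmeas k i).const_mul _
  refine ⟨hZ, aemeasurable_id, ?_⟩
  refine ProbabilityMeasure.tendsto_iff_tendsto_charFun.2 fun t => ?_
  -- Cramér–Wold: the characteristic function at `t` is that of the normalized scalar sums of `ξ` at
  -- `1`, where the one-dimensional theorem applies.
  set ξ : ℕ → Ω → ℝ := fun k ω => ∑ i, t i * W k ω i with hξ
  have hφ : Measurable (fun w : ι → ℝ => ∑ i, t i * w i) := by fun_prop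
  have hξi : iIndepFun ξ P := hindep.comp (fun _ w => ∑ i, t i * w i) fun _ => hφ
  have hξd : ∀ k, IdentDistrib (ξ k) (ξ 0) P P := fun k => (hident k).comp hφ
  have hξ2 : MemLp (ξ 0) 2 P := memLp_finsetSum _ fun i _ => (hL2 i).const_mul (t i)
  have hint : ∀ i, Integrable (fun ω => W 0 ω i) P := fun i => (hL2 i).integrable one_le_two
  have hξ0 : ∫ ω, ξ 0 ω ∂P = 0 := by
    simp only [hξ]
    rw [integral_finsetSum _ fun i _ => (hint i).const_mul (t i)]
    simp [integral_const_mul, h0]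
  have hξv : Var[ξ 0; P] = WithLp.ofLp t ⬝ᵥ S *ᵥ WithLp.ofLp t := by
    rw [variance_of_integral_eq_zero hξ2.1.aemeasurable hξ0]
    have h1 : ∀ ω, ξ 0 ω ^ 2 = ∑ i, ∑ j, (t i * t j) * (W 0 ω i * W 0 ω j) := by
      intro ω
      simp only [hξ]
      rw [sq, Finset.sum_mul_sum]
      exact Finset.sum_congr rfl fun i _ => Finset.sum_congr rfl fun j _ => by ring
    have h2 : ∀ i j, Integrable (fun ω => (t i * t j) * (W 0 ω i * W 0 ω j)) P := fun i j =>
      ((hL2 i).integrable_mul (hL2 j)).const_mul _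
    simp_rw [h1]
    rw [integral_finsetSum _ fun i _ => integrable_finsetSum _ fun j _ => h2 i j]
    simp only [dotProduct, Matrix.mulVec, Finset.mul_sum]
    refine Finset.sum_congr rfl fun i _ => ?_
    rw [integral_finsetSum _ fun j _ => h2 i j]
    refine Finset.sum_congr rfl fun j _ => ?_
    rw [integral_const_mul, hcov]
    ring
  have hclt := (tendstoInDistribution_inv_sqrt_mul_sum_sub
    (Y := id) (P' := gaussianReal 0 Var[ξ 0; P].toNNReal) ⟨aemeasurable_id, Measure.map_id⟩
    hξ2 hξi hξd).tendsto
  have hlim := ProbabilityMeasure.tendsto_iff_tendsto_charFun.1 hclt 1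
  simp only [hξ0, mul_zero, sub_zero, ProbabilityMeasure.coe_mk, Measure.map_id] at hlim ⊢
  have hg : charFun (gaussianReal 0 Var[ξ 0; P].toNNReal) 1 =
      charFun (multivariateGaussian 0 S) t := by
    rw [charFun_gaussianReal, charFun_multivariateGaussian hS, ← hξv]
    congr 1
    simp [Real.coe_toNNReal _ (variance_nonneg _ _)]
  rw [← hg]
  refine hlim.congr fun n => ?_
  rw [charFun_apply, charFun_apply, integral_map (hZ n) (by fun_prop), integral_map _ (by fun_prop)]
  · refine integral_congr_ae (Eventually.of_forall fun ω => ?_)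
    simp only
    rw [inner_toLp_eq_dotProduct]
    congr 3
    simp only [hξ, inner, one_mul]
    rw [Finset.sum_comm, Finset.mul_sum]
    refine Finset.sum_congr rfl fun i _ => ?_
    rw [← Finset.mul_sum]
    ring
  · exact (Finset.aemeasurable_fun_sum _ fun k _ => (hξd k).aemeasurable_fst).const_mul _

/-- The limit in distribution only depends on its law. -/
theorem tendstoInDistribution_id_of_map_eq {E Ω' : Type*} [TopologicalSpace E] [MeasurableSpace E]
    [OpensMeasurableSpace E] [MeasurableSpace Ω'] {P' : Measure Ω'} [IsProbabilityMeasure P']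
    {Y : ℕ → Ω → E} {Z : Ω' → E} (h : TendstoInDistribution Y atTop Z (fun _ => P) P')
    {ν : Measure E} [IsProbabilityMeasure ν] (hν : P'.map Z = ν) :
    TendstoInDistribution Y atTop id (fun _ => P) ν := by
  subst hν
  refine ⟨h.forall_aemeasurable, aemeasurable_id, ?_⟩
  simpa only [Measure.map_id] using h.tendsto

end Gaussian

/-! ### Measurability and continuity of matrix inversion. -/

section Inverse

variable {ι : Type*} [Fintype ι] [DecidableEq ι]

/-- Entries of the inverse are adjugate entries divided by the determinant; with `0⁻¹ = 0` this
formula also covers singular matrices, so no invertibility is needed. -/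
theorem measurable_inv_apply {Ω : Type*} [MeasurableSpace Ω] {A : Ω → Matrix ι ι ℝ}
    (hA : ∀ i j, Measurable fun ω => A ω i j) (i j : ι) : Measurable fun ω => (A ω)⁻¹ i j := by
  have hd : ∀ C : Ω → Matrix ι ι ℝ, (∀ i j, Measurable fun ω => C ω i j) →
      Measurable fun ω => (C ω).det := by
    intro C hC
    simp only [Matrix.det_apply]
    exact Finset.measurable_fun_sum _ fun σ _ =>
      (Finset.measurable_fun_prod _ fun k _ => hC _ _).const_smul _
  have hadj : Measurable fun ω => (A ω).adjugate i j := by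
    simp only [Matrix.adjugate_apply]
    refine hd _ fun k l => ?_
    by_cases hk : k = j
    · simp only [hk, Matrix.updateRow_self]; exact measurable_const
    · simp only [Matrix.updateRow_ne hk]; exact hA k l
  simp only [Matrix.inv_def, Matrix.smul_apply, Ring.inverse_eq_inv', smul_eq_mul]
  exact (hd A hA).inv.mul hadj

theorem tendsto_inv_apply {A : ℕ → Matrix ι ι ℝ} {B : Matrix ι ι ℝ} (hB : IsUnit B)
    (hA : ∀ i j, Tendsto (fun n => A n i j) atTop (𝓝 (B i j))) (i j : ι) :
    Tendsto (fun n => (A n)⁻¹ i j) atTop (𝓝 (B⁻¹ i j)) := by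
  have hA' : Tendsto A atTop (𝓝 B) :=
    tendsto_pi_nhds.2 fun i => tendsto_pi_nhds.2 fun j => hA i j
  have hdet : Tendsto (fun n => (A n).det) atTop (𝓝 B.det) :=
    ((continuous_id.matrix_det).tendsto B).comp hA'
  have hadj : Tendsto (fun n => (A n).adjugate i j) atTop (𝓝 (B.adjugate i j)) :=
    (((continuous_id.matrix_adjugate).matrix_elem i j).tendsto B).comp hA'
  simp only [Matrix.inv_def, Matrix.smul_apply, Ring.inverse_eq_inv', smul_eq_mul]
  exact (hdet.inv₀ ((Matrix.isUnit_iff_isUnit_det _).1 hB).ne_zero).mul hadj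

end Inverse

end MRP

namespace MRP

/-! ### Laws of large numbers, Slutsky's lemma and the limit law. -/

section Asymptotics

variable {X : Type*} [Countable X] [DecidableEq X] [MeasurableSpace X]
  [MeasurableSingletonClass X] {M : MRP X} {h : ℝ} {G : Finset X}

omit [Countable X] in
@[fun_prop]
theorem measurable_visitSum {f : Path X → ℝ} (hf : Measurable f) (s : X) :
    Measurable (visitSum f s) :=
  Measurable.tsum fun t => Measurable.ite (measurable_state t (measurableSet_singleton s))
    (hf.comp (measurable_shift t)) measurable_const

omit [Countable X] [MeasurableSingletonClass X] in
theorem Tame.ofReal_visitSum {s : X} (hs : s ≠ M.terminal) {f : Path X → ℝ} (hf : ∀ x, 0 ≤ f x)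
    {x : Path X} (hx : M.Tame x) :
    ENNReal.ofReal (visitSum f s x) =
      ∑' t, if state t x = s then ENNReal.ofReal (f (shift t x)) else 0 := by
  obtain ⟨T, hT⟩ := hx.exists_terminal
  have h0 : ∀ t ≥ T, ¬ state t x = s := fun t ht h => hs (by rw [← h, state, hT t ht])
  rw [visitSum_eq_sum hs hT, tsum_eq_sum_range_of_terminal fun t ht => if_neg (h0 t ht),
    ENNReal.ofReal_sum_of_nonneg]
  · refine Finset.sum_congr rfl fun t _ => ?_
    split_ifs <;> simp
  · intro t _
    split_ifs
    · exact hf _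
    · exact le_rfl

omit [Countable X] [MeasurableSingletonClass X] in
theorem Tame.visitSum_le {s : X} (hs : s ≠ M.terminal) {f : Path X → ℝ}
    (hf1 : ∀ x, f x ≤ 1) {x : Path X} (hx : M.Tame x) : visitSum f s x ≤ (M.life x).toReal := by
  obtain ⟨T, hT⟩ := hx.exists_terminal
  rw [visitSum_eq_sum hs hT]
  refine (Finset.sum_le_sum fun t _ => ?_).trans (hx.sum_alive_le (Finset.range T))
  split_ifs with h
  · rw [alive_of_ne (h ▸ hs)]; exact hf1 _
  · exact alive_nonneg t x

omit [Countable X] [MeasurableSpace X] [MeasurableSingletonClass X] in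
theorem visitSum_nonneg {f : Path X → ℝ} (hf : ∀ x, 0 ≤ f x) (s : X) (x : Path X) :
    0 ≤ visitSum f s x :=
  tsum_nonneg fun t => by
    split_ifs
    · exact hf _
    · exact le_rfl

theorem integrable_visitSum (hEff : M.EffectiveHorizon h) (hRew : M.BoundedReward) {s : X}
    (hs : s ≠ M.terminal) {f : Path X → ℝ} (hf : Measurable f) (hf0 : ∀ x, 0 ≤ f x)
    (hf1 : ∀ x, f x ≤ 1) : Integrable (visitSum f s) (M.pathLaw M.init) := by
  refine (integrable_life hEff hRew M.init).mono' (by fun_prop) ?_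
  filter_upwards [ae_tame hEff hRew M.init] with x hx
  rw [Real.norm_eq_abs, abs_of_nonneg (visitSum_nonneg hf0 s x)]
  exact hx.visitSum_le hs hf1

/-- The real form of `lintegral_tsum_visits`. Constant `f` and transition indicators give the limits
of the denominators and numerators of the empirical transition matrix. -/
theorem integral_visitSum (hEff : M.EffectiveHorizon h) (hRew : M.BoundedReward) {s : X}
    (hs : s ≠ M.terminal) {f : Path X → ℝ} (hf : Measurable f) (hf0 : ∀ x, 0 ≤ f x) :
    ∫ x, visitSum f s x ∂(M.pathLaw M.init) =
      (M.occupancy s).toReal * (∫⁻ y, ENNReal.ofReal (f y) ∂(M.lawFrom s)).toReal := by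
  rw [integral_eq_lintegral_of_nonneg_ae
    (Eventually.of_forall fun x => visitSum_nonneg hf0 s x)
    (by fun_prop), ← ENNReal.toReal_mul, occupancy, ← M.lintegral_tsum_visits M.init s
    hf.ennreal_ofReal]
  congr 1
  refine lintegral_congr_ae ?_
  filter_upwards [ae_tame hEff hRew M.init] with x hx
  exact hx.ofReal_visitSum hs hf0

theorem integral_visitSum_one (hEff : M.EffectiveHorizon h) (hRew : M.BoundedReward) {s : X}
    (hs : s ≠ M.terminal) :
    ∫ x, visitSum (fun _ => 1) s x ∂(M.pathLaw M.init) = (M.occupancy s).toReal := by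
  rw [integral_visitSum hEff hRew hs measurable_const fun _ => zero_le_one]
  simp

omit [Countable X] in
theorem measurable_ite_state_one (s' : X) :
    Measurable (fun y : Path X => if state 1 y = s' then (1 : ℝ) else 0) :=
  Measurable.ite (measurable_state 1 (measurableSet_singleton s')) measurable_const
    measurable_const

theorem integral_visitSum_transition (hEff : M.EffectiveHorizon h) (hRew : M.BoundedReward) {s : X}
    (hs : s ≠ M.terminal) (s' : X) :
    ∫ x, visitSum (fun y => if state 1 y = s' then 1 else 0) s x ∂(M.pathLaw M.init) =
      (M.occupancy s).toReal * (M.trans s).real {s'} := by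
  rw [integral_visitSum hEff hRew hs (measurable_ite_state_one s')
    (fun x => ite_nonneg zero_le_one le_rfl)]
  have h1 : ∀ y : Path X, ENNReal.ofReal (if state 1 y = s' then 1 else 0) =
      {y | state 1 y = s'}.indicator 1 y := by
    intro y
    by_cases hy : state 1 y = s' <;> simp [hy]
  simp_rw [h1]
  have hms : MeasurableSet {y : Path X | state 1 y = s'} :=
    measurable_state 1 (measurableSet_singleton s')
  rw [lintegral_indicator_one hms, Measure.real,
    ← M.map_state_one s, Measure.map_apply (measurable_state 1) (measurableSet_singleton s')]
  rfl

variable {Ω : Type*} [MeasurableSpace Ω] {P : Measure Ω} [IsProbabilityMeasure P]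
  {τ : ℕ → Ω → Path X}

omit [DecidableEq X] [IsProbabilityMeasure P] in
theorem ae_terminates_data (hEff : M.EffectiveHorizon h) (hRew : M.BoundedReward)
    (hlaw : ∀ i, HasLaw (τ i) (M.pathLaw M.init) P) :
    ∀ᵐ ω ∂P, ∀ i, ∃ T, ∀ t ≥ T, τ i ω t = (M.terminal, 0) := by
  refine ae_all_iff.2 fun i => ?_
  have h1 : ∀ᵐ x ∂(M.pathLaw M.init), ∃ T, ∀ t ≥ T, x t = (M.terminal, 0) := by
    filter_upwards [ae_tame hEff hRew M.init] with x hx using hx.exists_terminal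
  rw [← (hlaw i).map_eq] at h1
  exact ae_of_ae_map (hlaw i).aemeasurable h1

omit [Countable X] [DecidableEq X] [MeasurableSingletonClass X] [IsProbabilityMeasure P] in
theorem identDistrib_data (hlaw : ∀ i, HasLaw (τ i) (M.pathLaw M.init) P) (i : ℕ) :
    IdentDistrib (τ i) (τ 0) P P :=
  ⟨(hlaw i).aemeasurable, (hlaw 0).aemeasurable, by rw [(hlaw i).map_eq, (hlaw 0).map_eq]⟩

omit [Countable X] [DecidableEq X] [MeasurableSingletonClass X] [IsProbabilityMeasure P] in
/-- The strong law of large numbers for the data. -/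
theorem tendsto_empirical_mean (hlaw : ∀ i, HasLaw (τ i) (M.pathLaw M.init) P)
    (hind : iIndepFun τ P) {f : Path X → ℝ} (hf : Measurable f)
    (hi : Integrable f (M.pathLaw M.init)) :
    ∀ᵐ ω ∂P, Tendsto (fun n : ℕ => (∑ i : Fin n, f (τ i ω)) / n) atTop
      (𝓝 (∫ x, f x ∂(M.pathLaw M.init))) := by
  have hi0 : Integrable (f ∘ τ 0) P := by
    rw [← (hlaw 0).map_eq] at hi
    exact hi.comp_aemeasurable (hlaw 0).aemeasurable
  have hmean : ∫ ω, (f ∘ τ 0) ω ∂P = ∫ x, f x ∂(M.pathLaw M.init) := by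
    rw [← (hlaw 0).map_eq, integral_map (hlaw 0).aemeasurable hf.aestronglyMeasurable]
    rfl
  have h1 := strong_law_ae_real (fun i => f ∘ τ i) hi0
    (fun i j hij => (hind.indepFun hij).comp hf hf)
    (fun i => (identDistrib_data hlaw i).comp hf)
  rw [hmean] at h1
  filter_upwards [h1] with ω hω
  refine hω.congr fun n => ?_
  rw [Fin.sum_univ_eq_sum_range (fun i => f (τ i ω)) n]
  rfl

omit [IsProbabilityMeasure P] in
theorem ae_tendsto_counts (hEff : M.EffectiveHorizon h) (hRew : M.BoundedReward)
    (hterm : M.terminal ∉ G)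
    (hlaw : ∀ i, HasLaw (τ i) (M.pathLaw M.init) P) (hind : iIndepFun τ P) :
    ∀ᵐ ω ∂P, ∀ s : G,
      Tendsto (fun n : ℕ => (∑ i : Fin n, visitSum (fun _ => 1) (s : X) (τ i ω)) / n) atTop
        (𝓝 (M.occupancy s).toReal) := by
  refine ae_all_iff.2 fun s => ?_
  have hs : (s : X) ≠ M.terminal := fun he => hterm (he ▸ s.2)
  have := tendsto_empirical_mean hlaw hind (measurable_visitSum measurable_const (s : X))
    (integrable_visitSum hEff hRew hs (f := fun _ => 1) measurable_const (fun _ => zero_le_one)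
      (fun _ => le_rfl))
  rwa [integral_visitSum_one hEff hRew hs] at this

omit [IsProbabilityMeasure P] in
theorem ae_tendsto_empTransMatrix (hEff : M.EffectiveHorizon h) (hRew : M.BoundedReward)
    (hterm : M.terminal ∉ G) (hν : ∀ s ∈ G, 0 < M.occupancy s)
    (hlaw : ∀ i, HasLaw (τ i) (M.pathLaw M.init) P) (hind : iIndepFun τ P) :
    ∀ᵐ ω ∂P, ∀ s s' : G,
      Tendsto (fun n : ℕ => empTransMatrix G (fun i : Fin n => τ i ω) s s') atTop
        (𝓝 (M.transOn G s s')) := by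
  have h1 : ∀ᵐ ω ∂P, ∀ s s' : G, Tendsto (fun n : ℕ => (∑ i : Fin n,
      visitSum (fun y => if state 1 y = (s' : X) then 1 else 0) (s : X) (τ i ω)) / n) atTop
        (𝓝 ((M.occupancy s).toReal * (M.trans s).real {(s' : X)})) := by
    refine ae_all_iff.2 fun s => ae_all_iff.2 fun s' => ?_
    have hs : (s : X) ≠ M.terminal := fun he => hterm (he ▸ s.2)
    have := tendsto_empirical_mean hlaw hind
      (measurable_visitSum (measurable_ite_state_one (s' : X)) (s : X))
      (integrable_visitSum hEff hRew hs (measurable_ite_state_one (s' : X))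
        (fun _ => ite_nonneg zero_le_one le_rfl) (fun x => by split_ifs <;> simp))
    rwa [integral_visitSum_transition hEff hRew hs] at this
  filter_upwards [h1, ae_tendsto_counts hEff hRew hterm hlaw hind] with ω hω1 hω2 s s'
  have hs : (s : X) ≠ M.terminal := fun he => hterm (he ▸ s.2)
  have hν0 : (M.occupancy s).toReal ≠ 0 := ENNReal.toReal_ne_zero.2
    ⟨(hν s s.2).ne', (occupancy_lt_top hEff hRew hs).ne⟩
  have h3 := (hω1 s s').div (hω2 s) hν0
  rw [mul_div_cancel_left₀ _ hν0] at h3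
  refine h3.congr' ?_
  filter_upwards [eventually_ne_atTop 0] with n hn
  -- The empirical transition probability is a ratio of two averages; their common factor `1/n`
  -- cancels.
  have hn' : (n : ℝ) ≠ 0 := Nat.cast_ne_zero.2 hn
  simp only [Pi.div_apply]
  rw [div_div_div_cancel_right₀ hn']
  rfl

omit [Countable X] in
theorem measurable_empMean (n : ℕ) {f : Path X → ℝ} (hf : Measurable f) (s : X) :
    Measurable (fun D : Fin n → Path X => empMean D f s) := by
  simp only [empMean_eq]
  exact (Finset.measurable_fun_sum _ fun i _ =>
    (measurable_visitSum hf s).comp (measurable_pi_apply i)).div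
      (Finset.measurable_fun_sum _ fun i _ =>
        (measurable_visitSum measurable_const s).comp (measurable_pi_apply i))

omit [Countable X] in
theorem measurable_inv_one_sub_empTransMatrix (n : ℕ) (s s' : G) :
    Measurable (fun D : Fin n → Path X => (1 - empTransMatrix G D)⁻¹ s s') := by
  refine measurable_inv_apply (fun i j => ?_) s s'
  exact measurable_const.sub (measurable_empMean n (measurable_ite_state_one (j : X)) (i : X))

omit [Countable X] [DecidableEq X] [MeasurableSingletonClass X] [IsProbabilityMeasure P] in
theorem aemeasurable_data (hlaw : ∀ i, HasLaw (τ i) (M.pathLaw M.init) P) (n : ℕ) :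
    AEMeasurable (fun ω => fun i : Fin n => τ i ω) P :=
  aemeasurable_pi_lambda _ fun i => (hlaw i).aemeasurable

omit [IsProbabilityMeasure P] in
/-- Any estimator that solves the empirical equation almost surely is almost everywhere
measurable. -/
theorem aemeasurable_estimate (hEff : M.EffectiveHorizon h) (hRew : M.BoundedReward)
    (hterm : M.terminal ∉ G) (hlaw : ∀ i, HasLaw (τ i) (M.pathLaw M.init) P)
    {n : ℕ} {v : Ω → G → ℝ}
    (hv : ∀ᵐ ω ∂P, IsSubgraphBellman G (fun i : Fin n => τ i ω) (v ω)) (s : G) :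
    AEMeasurable (fun ω => v ω s) P := by
  have hout : Measurable (fun x : Path X => if state 1 x ∉ G then rewardToGo 1 x else 0) :=
    Measurable.ite measurableSet_exit (measurable_rewardToGo 1) measurable_const
  have hm : Measurable (fun D : Fin n → Path X => ((1 - empTransMatrix G D)⁻¹ *ᵥ
      fun s : G => empReward D s + empOut G D s) s) :=
    Finset.measurable_fun_sum _ fun b _ => (measurable_inv_one_sub_empTransMatrix n s b).mul
      ((measurable_empMean n (measurable_rew 0) (b : X)).add
        (measurable_empMean n hout (b : X)))
  -- By uniqueness of the solution, `v` agrees almost everywhere with an explicit measurable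
  -- function of the data.
  refine (hm.comp_aemeasurable (aemeasurable_data hlaw n)).congr ?_
  filter_upwards [hv, ae_terminates_data hEff hRew hlaw] with ω hω hT
  have := (isSubgraphBellman_iff_eq hterm (fun i : Fin n => hT i)).1 hω
  rw [Function.comp_apply, ← this]

variable (G τ) in
/-- The random matrix that maps the normalized scores to the estimation error. -/
noncomputable def errorMatrix (n : ℕ) (ω : Ω) : G → G → ℝ := fun s s' =>
  (1 - empTransMatrix G (fun i : Fin n => τ i ω))⁻¹ s s' *
    ((∑ i : Fin n, visitSum (fun _ => 1) (s' : X) (τ i ω)) / n)⁻¹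

omit [Countable X] [IsProbabilityMeasure P] in
theorem aemeasurable_errorMatrix (hlaw : ∀ i, HasLaw (τ i) (M.pathLaw M.init) P) (n : ℕ) :
    AEMeasurable (errorMatrix G τ n) P := by
  refine aemeasurable_pi_lambda _ fun s => aemeasurable_pi_lambda _ fun s' => ?_
  have hm : Measurable (fun D : Fin n → Path X => (1 - empTransMatrix G D)⁻¹ s s' *
      ((∑ i : Fin n, visitSum (fun _ => 1) (s' : X) (D i)) / n)⁻¹) :=
    (measurable_inv_one_sub_empTransMatrix n s s').mul
      ((Finset.measurable_fun_sum _ fun i _ =>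
        (measurable_visitSum measurable_const (s' : X)).comp (measurable_pi_apply i)).div_const
          _).inv
  exact hm.comp_aemeasurable (aemeasurable_data hlaw n)

omit [IsProbabilityMeasure P] in
theorem ae_tendsto_errorMatrix (hEff : M.EffectiveHorizon h) (hRew : M.BoundedReward)
    (hterm : M.terminal ∉ G) (hν : ∀ s ∈ G, 0 < M.occupancy s) (hG : M.IsTransient G)
    (hlaw : ∀ i, HasLaw (τ i) (M.pathLaw M.init) P) (hind : iIndepFun τ P) :
    ∀ᵐ ω ∂P, Tendsto (fun n => errorMatrix G τ n ω) atTop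
      (𝓝 fun s s' => ((1 - M.transOn G)⁻¹ *
        Matrix.diagonal fun s : G => 1 / (M.occupancy s).toReal) s s') := by
  filter_upwards [ae_tendsto_counts hEff hRew hterm hlaw hind,
    ae_tendsto_empTransMatrix hEff hRew hterm hν hlaw hind] with ω h1 h2
  refine tendsto_pi_nhds.2 fun s => tendsto_pi_nhds.2 fun s' => ?_
  have hν0 : (M.occupancy s').toReal ≠ 0 := ENNReal.toReal_ne_zero.2 ⟨(hν s' s'.2).ne',
    (occupancy_lt_top hEff hRew (fun he => hterm (he ▸ s'.2))).ne⟩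
  rw [Matrix.mul_diagonal, one_div]
  refine Tendsto.mul ?_ ((h1 s').inv₀ hν0)
  refine tendsto_inv_apply (isUnit_one_sub_transOn hEff hRew hterm hG) (fun i j => ?_) s s'
  exact tendsto_const_nhds.sub (h2 i j)

omit [IsProbabilityMeasure P] in
/-- The normalized estimation error is eventually the image of the normalized scores. -/
theorem ae_eventually_error_eq (hEff : M.EffectiveHorizon h) (hRew : M.BoundedReward)
    (hterm : M.terminal ∉ G) (hν : ∀ s ∈ G, 0 < M.occupancy s)
    (hlaw : ∀ i, HasLaw (τ i) (M.pathLaw M.init) P) (hind : iIndepFun τ P)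
    {Vhat : ℕ → Ω → G → ℝ}
    (hV : ∀ n : ℕ, ∀ᵐ ω ∂P, IsSubgraphBellman G (fun i : Fin n => τ i ω) (Vhat n ω)) :
    ∀ᵐ ω ∂P, ∀ᶠ n : ℕ in atTop, ∀ s : G, √(n : ℝ) * (M.value s - Vhat n ω s) =
      ∑ s' : G, errorMatrix G τ n ω s s' *
        ((√(n : ℝ))⁻¹ * ∑ k ∈ Finset.range n, M.score G s' (τ k ω)) := by
  filter_upwards [ae_all_iff.2 hV, ae_terminates_data hEff hRew hlaw,
    ae_tendsto_counts hEff hRew hterm hlaw hind] with ω hω hT hN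
  -- The identity requires every state of `G` to have been visited, which holds eventually because
  -- the normalized counts converge to `ν > 0`.
  have hN' : ∀ s : G, ∀ᶠ n : ℕ in atTop,
      (∑ i : Fin n, visitSum (fun _ => 1) (s : X) (τ i ω)) / n ≠ 0 := fun s =>
    (hN s).eventually_ne (ENNReal.toReal_ne_zero.2 ⟨(hν s s.2).ne',
      (occupancy_lt_top hEff hRew (fun he => hterm (he ▸ s.2))).ne⟩)
  filter_upwards [eventually_all.2 hN', eventually_gt_atTop 0] with n hn hn0 s
  have hn' : (0 : ℝ) < n := Nat.cast_pos.2 hn0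
  rw [value_sub_estimate_eq hterm (fun i : Fin n => hT i)
    (fun b hb => (div_ne_zero_iff.1 (hn ⟨b, hb⟩)).1) (hω n) s, Finset.mul_sum]
  refine Finset.sum_congr rfl fun b _ => ?_
  rw [errorMatrix, ← Fin.sum_univ_eq_sum_range (fun k => M.score G b (τ k ω)) n, inv_div]
  -- The factor `n` turns inverse counts into the inverse normalized counts of `errorMatrix`; the
  -- factor `1/√n` goes to the scores.
  have hsq : √(n : ℝ) = n * (√(n : ℝ))⁻¹ := by
    rw [eq_mul_inv_iff_mul_eq₀ (Real.sqrt_pos.2 hn').ne', Real.mul_self_sqrt hn'.le]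
  conv_lhs => rw [hsq]
  ring

theorem posSemidef_lambdaStar (hEff : M.EffectiveHorizon h) (hRew : M.BoundedReward)
    (hterm : M.terminal ∉ G) (hG : M.IsTransient G) : (M.lambdaStar G).PosSemidef := by
  rw [lambdaStar_eq_diagonal hEff hRew hterm hG]
  exact Matrix.PosSemidef.diagonal fun s =>
    mul_nonneg ENNReal.toReal_nonneg (visitVar_nonneg (s : X))

theorem tendstoInDistribution_score (hEff : M.EffectiveHorizon h) (hRew : M.BoundedReward)
    (hterm : M.terminal ∉ G) (hG : M.IsTransient G)
    (hlaw : ∀ i, HasLaw (τ i) (M.pathLaw M.init) P) (hind : iIndepFun τ P) :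
    TendstoInDistribution (fun (n : ℕ) ω => (WithLp.toLp 2 fun s : G =>
      (√(n : ℝ))⁻¹ * ∑ k ∈ Finset.range n, M.score G s (τ k ω) : EuclideanSpace ℝ G))
      atTop id (fun _ => P) (multivariateGaussian 0 (M.lambdaStar G)) := by
  have hφ : Measurable (fun (x : Path X) (s : G) => M.score G s x) :=
    measurable_pi_lambda _ fun s => measurable_score (s : X)
  have hint : ∀ f : Path X → ℝ, Measurable f →
      ∫ ω, f (τ 0 ω) ∂P = ∫ x, f x ∂(M.pathLaw M.init) := by
    intro f hf
    rw [← (hlaw 0).map_eq, integral_map (hlaw 0).aemeasurable hf.aestronglyMeasurable]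
  refine tendstoInDistribution_multivariateGaussian
    (W := fun k ω (s : G) => M.score G s (τ k ω))
    (hind.comp (fun _ x (s : G) => M.score G s x) fun _ => hφ)
    (fun k => (identDistrib_data hlaw k).comp hφ) (fun s => ?_) (fun s => ?_)
    (posSemidef_lambdaStar hEff hRew hterm hG) (fun s s' => ?_)
  · have h1 := memLp_score hEff hRew hterm hG M.init s.2
    rw [← (hlaw 0).map_eq] at h1
    exact h1.comp_of_map (hlaw 0).aemeasurable
  · rw [hint _ (measurable_score (s : X)), integral_score hEff hRew hterm hG M.init s.2]
  · rw [hint (fun x => M.score G s x * M.score G s' x)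
      ((measurable_score (s : X)).mul (measurable_score (s' : X))), lambdaStar, Matrix.of_apply,
      covariance, integral_score hEff hRew hterm hG M.init s.2,
      integral_score hEff hRew hterm hG M.init s'.2]
    simp only [sub_zero]

theorem posSemidef_limit (hEff : M.EffectiveHorizon h) (hRew : M.BoundedReward)
    (hterm : M.terminal ∉ G) (hν : ∀ s ∈ G, 0 < M.occupancy s) (hG : M.IsTransient G) :
    ((1 - M.transOn G)⁻¹ * M.sigmaStar G * ((1 - M.transOn G)⁻¹)ᵀ).PosSemidef := by
  have h1 : (M.sigmaStar G).PosSemidef := by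
    rw [sigmaStar_eq_diagonal hEff hRew hterm hν hG]
    exact Matrix.PosSemidef.diagonal fun s => effVar_nonneg (s : X)
  have := h1.mul_mul_conjTranspose_same (1 - M.transOn G)⁻¹
  rwa [Matrix.conjTranspose_eq_transpose_of_trivial] at this

/-- Asymptotic normality of the subgraph Bellman estimator. -/
theorem tendstoInDistribution_error (hEff : M.EffectiveHorizon h) (hRew : M.BoundedReward)
    (hterm : M.terminal ∉ G) (hν : ∀ s ∈ G, 0 < M.occupancy s) (hG : M.IsTransient G)
    (hlaw : ∀ i, HasLaw (τ i) (M.pathLaw M.init) P) (hind : iIndepFun τ P)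
    {Vhat : ℕ → Ω → G → ℝ}
    (hV : ∀ n : ℕ, ∀ᵐ ω ∂P, IsSubgraphBellman G (fun i : Fin n => τ i ω) (Vhat n ω)) :
    TendstoInDistribution
      (fun (n : ℕ) (ω : Ω) =>
        (WithLp.toLp 2 (fun s : G => √(n : ℝ) * (M.value s - Vhat n ω s)) : EuclideanSpace ℝ G))
      atTop id (fun _ => P)
      (multivariateGaussian 0
        ((1 - M.transOn G)⁻¹ * M.sigmaStar G * ((1 - M.transOn G)⁻¹)ᵀ)) := by
  set B : Matrix G G ℝ := (1 - M.transOn G)⁻¹ *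
    Matrix.diagonal fun s : G => 1 / (M.occupancy s).toReal with hB
  let g : EuclideanSpace ℝ G × (G → G → ℝ) → EuclideanSpace ℝ G := fun p =>
    WithLp.toLp 2 fun s => ∑ s' : G, p.2 s s' * p.1 s'
  have hg : Continuous g := by
    refine (PiLp.continuous_toLp 2 _).comp (continuous_pi fun s => ?_)
    fun_prop
  -- Slutsky's lemma: the scores converge in law, the random matrix almost surely to the constant
  -- `B`, and `g` is jointly continuous.
  have hslutsky := (tendstoInDistribution_score hEff hRew hterm hG hlaw
    hind).continuous_comp_prodMk_of_tendstoInMeasure_const hg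
    (tendstoInMeasure_of_tendsto_ae
      (fun n => (aemeasurable_errorMatrix hlaw n).aestronglyMeasurable)
      (ae_tendsto_errorMatrix hEff hRew hterm hν hG hlaw hind))
    (fun n => aemeasurable_errorMatrix hlaw n)
  have hmeas : ∀ n : ℕ, AEMeasurable (fun ω => (WithLp.toLp 2
      (fun s : G => √(n : ℝ) * (M.value s - Vhat n ω s)) : EuclideanSpace ℝ G)) P := by
    intro n
    refine (WithLp.measurable_toLp 2 _).comp_aemeasurable (aemeasurable_pi_lambda _ fun s => ?_)
    exact ((aemeasurable_estimate hEff hRew hterm hlaw (hV n) s).const_sub _).const_mul _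
  -- The error equals this image only for large `n`, so their difference is almost surely eventually
  -- zero, which is enough to transfer the limit.
  have hlim := tendstoInDistribution_of_tendstoInMeasure_sub
    (fun (n : ℕ) ω => (WithLp.toLp 2
      (fun s : G => √(n : ℝ) * (M.value s - Vhat n ω s)) : EuclideanSpace ℝ G)) _ hslutsky
    (tendstoInMeasure_of_tendsto_ae
      (fun n => ((hmeas n).sub (hslutsky.forall_aemeasurable n)).aestronglyMeasurable) (by
        filter_upwards [ae_eventually_error_eq hEff hRew hterm hν hlaw hind hV] with ω hω
        refine tendsto_const_nhds.congr' ?_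
        filter_upwards [hω] with n hn
        refine (sub_eq_zero.2 ?_).symm
        exact congrArg (WithLp.toLp 2) (funext hn))) hmeas
  refine tendstoInDistribution_id_of_map_eq hlim ?_
  have hmap := map_mulVec_multivariateGaussian (posSemidef_lambdaStar hEff hRew hterm hG) B
  -- The factor `diag(1/ν)` of `B` is absorbed in `Σ⋆`.
  have hmat : B * M.lambdaStar G * Bᵀ =
      (1 - M.transOn G)⁻¹ * M.sigmaStar G * ((1 - M.transOn G)⁻¹)ᵀ := by
    rw [hB, sigmaStar, Matrix.transpose_mul, Matrix.diagonal_transpose]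
    simp only [Matrix.mul_assoc]
  rw [← hmat, ← hmap]
  rfl

/-- With a diagonal middle factor, a diagonal entry of `A D Aᵀ` is a sum of squared row entries of
`A` weighted by `D`, and here `A` is the matrix of expected visits. -/
theorem limit_diag (hEff : M.EffectiveHorizon h) (hRew : M.BoundedReward)
    (hterm : M.terminal ∉ G) (hν : ∀ s ∈ G, 0 < M.occupancy s) (hG : M.IsTransient G) (s : G) :
    ((1 - M.transOn G)⁻¹ * M.sigmaStar G * ((1 - M.transOn G)⁻¹)ᵀ : Matrix G G ℝ) s s =
      ∑ s' : G, (M.expectedVisits s s').toReal ^ 2 * M.effVar G s' := by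
  rw [sigmaStar_eq_diagonal hEff hRew hterm hν hG, inv_one_sub_transOn hEff hRew hterm hG,
    Matrix.mul_apply]
  refine Finset.sum_congr rfl fun b _ => ?_
  rw [Matrix.mul_diagonal, Matrix.transpose_apply, visitsMatrix, Matrix.of_apply]
  ring

theorem tendstoInDistribution_error_apply (hEff : M.EffectiveHorizon h) (hRew : M.BoundedReward)
    (hterm : M.terminal ∉ G) (hν : ∀ s ∈ G, 0 < M.occupancy s) (hG : M.IsTransient G)
    (hlaw : ∀ i, HasLaw (τ i) (M.pathLaw M.init) P) (hind : iIndepFun τ P)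
    {Vhat : ℕ → Ω → G → ℝ}
    (hV : ∀ n : ℕ, ∀ᵐ ω ∂P, IsSubgraphBellman G (fun i : Fin n => τ i ω) (Vhat n ω)) (s : G) :
    TendstoInDistribution (fun (n : ℕ) (ω : Ω) => √(n : ℝ) * (M.value s - Vhat n ω s))
      atTop id (fun _ => P) (gaussianReal 0
        (∑ s' : G, (M.expectedVisits s s').toReal ^ 2 * M.effVar G s').toNNReal) := by
  have h1 := (tendstoInDistribution_error hEff hRew hterm hν hG hlaw hind hV).continuous_comp
    (g := fun z : EuclideanSpace ℝ G => z s) (by fun_prop)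
  refine tendstoInDistribution_id_of_map_eq h1 ?_
  have h2 := (measurePreserving_eval_multivariateGaussian (μ := 0)
    (posSemidef_limit hEff hRew hterm hν hG) (i := s)).map_eq
  rw [limit_diag hEff hRew hterm hν hG s] at h2
  exact h2

end Asymptotics

end MRP

theorem corollary1
    {X : Type*} [Countable X] [MeasurableSpace X] [MeasurableSingletonClass X] [DecidableEq X]
    (M : MRP X) (h : ℝ) (hEff : M.EffectiveHorizon h) (hRew : M.BoundedReward)
    (G : Finset X) (hterm : M.terminal ∉ G) (hν : ∀ s ∈ G, 0 < M.occupancy s)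
    (hG : M.IsTransient G)
    {Ω : Type*} [MeasurableSpace Ω] (P : Measure Ω) [IsProbabilityMeasure P]
    (τ : ℕ → Ω → MRP.Path X) (hlaw : ∀ i, HasLaw (τ i) (M.pathLaw M.init) P)
    (hind : iIndepFun τ P) :
    M.WellDefined G ∧
    IsUnit (1 - M.transOn G) ∧
    M.sigmaStar G = Matrix.diagonal (fun s : G => M.effVar G s) ∧
    (∀ n : ℕ, ∀ᵐ ω ∂P, ∃! v : G → ℝ, MRP.IsSubgraphBellman G (fun i : Fin n => τ i ω) v) ∧
    ∀ Vhat : ℕ → Ω → G → ℝ,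
      (∀ n : ℕ, ∀ᵐ ω ∂P, MRP.IsSubgraphBellman G (fun i : Fin n => τ i ω) (Vhat n ω)) →
      TendstoInDistribution
        (fun (n : ℕ) (ω : Ω) =>
          (WithLp.toLp 2 (fun s : G => √(n : ℝ) * (M.value s - Vhat n ω s)) : EuclideanSpace ℝ G))
        atTop id (fun _ => P)
        (multivariateGaussian 0
          ((1 - M.transOn G)⁻¹ * M.sigmaStar G * ((1 - M.transOn G)⁻¹)ᵀ)) ∧
      ∀ s : G,
        TendstoInDistribution
          (fun (n : ℕ) (ω : Ω) => √(n : ℝ) * (M.value s - Vhat n ω s))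
          atTop id (fun _ => P)
          (gaussianReal 0
            (∑ s' : G, (M.expectedVisits s s').toReal ^ 2 * M.effVar G s').toNNReal) := by
  refine ⟨MRP.wellDefined hEff hRew hterm hG, MRP.isUnit_one_sub_transOn hEff hRew hterm hG,
    MRP.sigmaStar_eq_diagonal hEff hRew hterm hν hG, fun n => ?_, fun Vhat hV =>
      ⟨MRP.tendstoInDistribution_error hEff hRew hterm hν hG hlaw hind hV,
       MRP.tendstoInDistribution_error_apply hEff hRew hterm hν hG hlaw hind hV⟩⟩
  filter_upwards [MRP.ae_terminates_data hEff hRew hlaw] with ω hω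
  exact MRP.existsUnique_isSubgraphBellman hterm (fun i : Fin n => hω i)
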